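/- Let $M$ be a connected smooth manifold (Hausdorff, second countable) of dimension $2n$, let $\kappa$ be an almost symplectic form on $M$, i.e. a smooth nondegenerate $2$-form, and let $g$ be a smooth Riemannian metric on $M$ whose Riemannian volume form, for the orientation of $M$ defined by $\kappa^n$, is $\kappa^n/n!$. Let $R$ be the field of endomorphisms of $TM$ given by $g(X,Y)=\kappa(RX,Y)$. For a smooth field $S$ of endomorphisms of $TM$ let $$N_S(X,Y)=[SX,SY]+S^2[X,Y]-S[SX,Y]-S[X,SY]$$ be its Nijenhuis tensor. Let $J$ be the orthogonal factor of $R$ in its $g$-polar decomposition, i.e. at every point $R=SJ$ with $S$ symmetric and positive definite with respect to $g$ and with $J$ orthogonal with respect to $g$. If $N_R=0$, then $J$ is smooth and skew-symmetric with respect to $g$, and $N_J=0$. If moreover $d\kappa=0$, then $(M,g,J)$ is a Kähler manifold: $J$ is smooth, $J^2=-\mathrm{Id}$, $g(JX,JY)=g(X,Y)$, $N_J=0$, and the $2$-form $g(J\cdot,\cdot)$ is closed. -/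

import Mathlib

open Bundle VectorField
open scoped Manifold ContDiff

noncomputable section

namespace AlmostSymplectic

variable {E : Type*} [NormedAddCommGroup E] [NormedSpace ℝ E]
  {H : Type*} [TopologicalSpace H] (I : ModelWithCorners ℝ E H)
  (M : Type*) [TopologicalSpace M] [ChartedSpace H M]
  [IsManifold I ∞ M]

/-- A (not necessarily smooth) vector field. -/
abbrev VField := Π x : M, TangentSpace I x

/-- A (not necessarily smooth) field of bilinear forms on the tangent spaces. -/
abbrev BilinField := Π x : M, TangentSpace I x →L[ℝ] TangentSpace I x →L[ℝ] ℝ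

/-- A (not necessarily smooth) field of endomorphisms of the tangent spaces. -/
abbrev EndField := Π x : M, TangentSpace I x →L[ℝ] TangentSpace I x

/-- A smooth Riemannian metric on `M`. -/
abbrev RiemMetric :=
  ContMDiffRiemannianMetric I ∞ E (fun x : M ↦ TangentSpace I x)

variable {M}

/-- The vector field `X` is smooth on the set `U`. -/
def SmoothFieldOn (X : VField I M) (U : Set M) : Prop :=
  ContMDiffOn I I.tangent ∞ (fun x ↦ (⟨x, X x⟩ : TangentBundle I M)) U

/-- The field of endomorphisms `R` is smooth, as a section of the bundle `End(TM)`. -/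
def SmoothEnd (R : EndField I M) : Prop :=
  ContMDiff I (I.prod 𝓘(ℝ, E →L[ℝ] E)) ∞
    (fun x ↦ TotalSpace.mk' (E →L[ℝ] E)
      (E := fun x : M ↦ TangentSpace I x →L[ℝ] TangentSpace I x) x (R x))

variable (M) in
/-- An almost symplectic form: a smooth nondegenerate alternating 2-form. -/
structure AlmostSymplecticForm where
  /-- The bilinear form on each tangent space. -/
  form : BilinField I M
  alt : ∀ x u, form x u u = 0
  nondegenerate : ∀ x u, (∀ v, form x u v = 0) → u = 0
  contMDiff : ContMDiff I (I.prod 𝓘(ℝ, E →L[ℝ] E →L[ℝ] ℝ)) ∞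
    (fun x ↦ TotalSpace.mk' (E →L[ℝ] E →L[ℝ] ℝ)
      (E := fun x : M ↦ TangentSpace I x →L[ℝ] TangentSpace I x →L[ℝ] ℝ) x (form x))

/-- The vector field `R X`. -/
def applyField (R : EndField I M) (X : VField I M) : VField I M := fun x ↦ R x (X x)

/-- The value `[RX, RY] + R²[X, Y] - R[RX, Y] - R[X, RY]` at `x` of the Nijenhuis tensor. -/
def nijenhuis (R : EndField I M) (X Y : VField I M) (x : M) : TangentSpace I x :=
  mlieBracket I (applyField I R X) (applyField I R Y) x
    + R x (R x (mlieBracket I X Y x))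
    - R x (mlieBracket I (applyField I R X) Y x)
    - R x (mlieBracket I X (applyField I R Y) x)

/-- The Nijenhuis tensor of `R` is identically zero: it vanishes on all smooth vector fields
that are defined on open subsets of `M`. -/
def NijenhuisZero (R : EndField I M) : Prop :=
  ∀ (U : Set M), IsOpen U → ∀ X Y : VField I M, SmoothFieldOn I X U → SmoothFieldOn I Y U →
    ∀ x ∈ U, nijenhuis I R X Y x = 0

/-- The derivative at `x` of the function `Ω(Y, Z)` in the direction of the vector field `X`. -/
def derivPairing (Ω : BilinField I M) (X Y Z : VField I M) (x : M) : ℝ :=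
  mfderiv I 𝓘(ℝ, ℝ) (fun y ↦ Ω y (Y y) (Z y)) x (X x)

/-- The value `dΩ(X, Y, Z)` at `x` of the exterior derivative of the 2-form `Ω`, by the
coordinate-free formula. -/
def extDerivTwo (Ω : BilinField I M) (X Y Z : VField I M) (x : M) : ℝ :=
  derivPairing I Ω X Y Z x - derivPairing I Ω Y X Z x + derivPairing I Ω Z X Y x
    - Ω x (mlieBracket I X Y x) (Z x)
    + Ω x (mlieBracket I X Z x) (Y x)
    - Ω x (mlieBracket I Y Z x) (X x)

/-- The (smooth) 2-form `Ω` is closed: `dΩ` vanishes on all smooth vector fields that are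
defined on open subsets of `M`. -/
def ClosedForm (Ω : BilinField I M) : Prop :=
  ∀ (U : Set M), IsOpen U → ∀ X Y Z : VField I M,
    SmoothFieldOn I X U → SmoothFieldOn I Y U → SmoothFieldOn I Z U →
    ∀ x ∈ U, extDerivTwo I Ω X Y Z x = 0

/-- The value on `v₀, …, v₂ₙ₋₁` of the `2n`-form `Ωⁿ / n!`, where `Ωⁿ = Ω ∧ ⋯ ∧ Ω` is the `n`-fold
wedge power of an alternating bilinear form `Ω`:
`Ωⁿ(v) = 2⁻ⁿ ∑_σ sgn(σ) Ω(v_{σ(0)}, v_{σ(1)}) ⋯ Ω(v_{σ(2n-2)}, v_{σ(2n-1)})`. -/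
def wedgePowDivFactorial {V : Type*} [AddCommGroup V] [Module ℝ V] [TopologicalSpace V]
    (Ω : V →L[ℝ] V →L[ℝ] ℝ) (n : ℕ) (v : Fin (2 * n) → V) : ℝ :=
  (1 / (n.factorial : ℝ)) * ((1 / 2 ^ n) *
    ∑ σ : Equiv.Perm (Fin (2 * n)), ((Equiv.Perm.sign σ : ℤ) : ℝ) *
      ∏ i : Fin n, Ω (v (σ ⟨2 * i.1, by omega⟩)) (v (σ ⟨2 * i.1 + 1, by omega⟩)))

/-- `dμ(g) = κⁿ / n!` on a `2n`-manifold: the form `κⁿ / n!` is the Riemannian volume form of `g`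
for the orientation that `κⁿ` itself defines. On vectors `v₁, …, v₂ₙ` the Riemannian volume form
is `± √det(g(vᵢ, vⱼ))`, with the sign of the orientation of `(v₁, …, v₂ₙ)`, here the sign of
`κⁿ(v₁, …, v₂ₙ)`. -/
def HasVolumeForm (n : ℕ) (κ : AlmostSymplecticForm I M)
    (g : RiemMetric I M) : Prop :=
  ∀ (x : M) (v : Fin (2 * n) → TangentSpace I x),
    wedgePowDivFactorial (κ.form x) n v =
      (SignType.sign (wedgePowDivFactorial (κ.form x) n v) : ℝ) *
        Real.sqrt (Matrix.of fun i j ↦ g.inner x (v i) (v j)).det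

variable {I}

/-- `J` is the orthogonal factor of `R` in its `g`-polar decomposition: `R = S J` with `S`
symmetric and positive definite and `J` orthogonal with respect to `g`. -/
def IsPolarOrthogonalFactor (g : RiemMetric I M) (R J : EndField I M) : Prop :=
  ∃ S : EndField I M,
    (∀ x u v, g.inner x (S x u) v = g.inner x u (S x v)) ∧
    (∀ x u, u ≠ 0 → 0 < g.inner x (S x u) u) ∧
    (∀ x u v, g.inner x (J x u) (J x v) = g.inner x u v) ∧
    (∀ x u, R x u = S x (J x u))

/-- `J` is skew-symmetric with respect to `g`. -/
def IsSkew (g : RiemMetric I M) (J : EndField I M) : Prop :=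
  ∀ x u v, g.inner x (J x u) v = - g.inner x u (J x v)

/-- `(M, g, J)` is a Kähler manifold: `J` is a smooth integrable almost complex structure, `g` is
Hermitian for `J`, and the fundamental 2-form `g(J·, ·)` is closed. -/
structure IsKahler (g : RiemMetric I M) (J : EndField I M) : Prop where
  smooth : SmoothEnd I J
  sq_eq_neg : ∀ x u, J x (J x u) = - u
  hermitian : ∀ x u v, g.inner x (J x u) (J x v) = g.inner x u v
  nijenhuis : NijenhuisZero I J
  closed : ClosedForm I (fun x ↦ (g.inner x).comp (J x))

end AlmostSymplectic

end

noncomputable section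

namespace AlmostSymplectic

open Polynomial

/-! ### Linear algebra: traces, diagonalization and interpolation. -/

section Algebra

variable {V : Type*} [AddCommGroup V] [Module ℝ V]

/-! The heart of the matter is that `R` has constant spectrum. Since `κ` is alternating, `R` is skew
for `g`, so its odd powers are traceless. In a chart, `N_R = 0` gives `d tr(R^(k+1)) / (k+1) = (d
tr(R^k) / k) ∘ R` for `k ≥ 1`; hence the traces of the even powers are constant on the connected
manifold (`NijenhuisZero.trace_pow_const`). Let `P` have as simple roots the eigenvalues of `-R²` at
one point. The trace of `P(-R²)²` is constant, hence zero, and `P(-R²)` is symmetric, so it vanishes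
everywhere (`NijenhuisZero.exists_annihilator`).

The polar factor satisfies `S² = -R²`, so its eigenvalues lie in a fixed finite set of positive
numbers. Interpolation there writes `S⁻¹`, hence `J = S⁻¹R` and `S = S² S⁻¹`, as polynomials in `R`
with constant coefficients (`exists_polyEnd_eq_polar_factors`). Such polynomials are smooth and
inherit the vanishing of the Nijenhuis tensor (`NijenhuisZero.polyEnd`).

For the Kähler statement, `J² = -1` gives `g(J·,·) = κ(RJ·,·) = -κ(S·,·)`. As an even polynomial in
`R`, `S` is self-adjoint for `κ`, and splitting vector fields into eigenfields of `S` reduces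
`d(κ(S·,·))` to multiples of `dκ` (`closedForm_comp`). -/

theorem trace_eq_zero_of_skew [FiniteDimensional ℝ V] (B : V →ₗ[ℝ] V →ₗ[ℝ] ℝ)
    (hB : ∀ u, (∀ v, B u v = 0) → u = 0) (A : V →ₗ[ℝ] V)
    (hA : ∀ u v, B (A u) v = - B u (A v)) : LinearMap.trace ℝ V A = 0 := by
  have hinj : Function.Injective B := by
    rw [injective_iff_map_eq_zero]
    intro u hu
    exact hB u fun v ↦ by simp [hu]
  let e : V ≃ₗ[ℝ] Module.Dual ℝ V :=
    LinearEquiv.ofInjectiveOfFinrankEq B hinj (Subspace.dual_finrank_eq).symm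
  have he : ∀ u v, e u v = B u v := fun u v ↦ rfl
  -- `B` intertwines `A` with minus its transpose, so `tr A = -tr A`.
  have hconj : e.conj A = (-1 : ℝ) • Module.Dual.transpose A := by
    ext φ v
    obtain ⟨u, rfl⟩ := e.surjective φ
    simp [LinearEquiv.conj_apply, Module.Dual.transpose_apply, he, hA]
  have h1 := LinearMap.trace_conj' A e
  rw [hconj, map_smul, LinearMap.trace_transpose', smul_eq_mul] at h1
  linarith

/-- A map that is symmetric for an inner product is diagonalizable. -/
theorem exists_eigenbasis_of_symmetric [FiniteDimensional ℝ V] (g : V →ₗ[ℝ] V →ₗ[ℝ] ℝ)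
    (hs : ∀ u v, g u v = g v u) (hp : ∀ u, u ≠ 0 → 0 < g u u) (A : V →ₗ[ℝ] V)
    (hA : ∀ u v, g (A u) v = g u (A v)) :
    ∃ (b : Module.Basis (Fin (Module.finrank ℝ V)) ℝ V) (μ : Fin (Module.finrank ℝ V) → ℝ),
      ∀ i, A (b i) = μ i • b i := by
  let c : InnerProductSpace.Core ℝ V :=
    { inner := fun u v ↦ g u v
      conj_inner_symm := fun u v ↦ by simpa using hs v u
      re_inner_nonneg := fun u ↦ by
        by_cases h : u = 0
        · simp [h]
        · simpa using (hp u h).le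
      add_left := fun u v w ↦ by simp
      smul_left := fun u v r ↦ by simp
      definite := fun u hu ↦ by
        by_contra h
        exact (hp u h).ne' hu }
  let : NormedAddCommGroup V := c.toNormedAddCommGroup
  let : InnerProductSpace ℝ V := InnerProductSpace.ofCore c.toCore
  have hT : LinearMap.IsSymmetric A := fun u v ↦ hA u v
  refine ⟨(hT.eigenvectorBasis rfl).toBasis, hT.eigenvalues rfl, fun i ↦ ?_⟩
  simp [hT.apply_eigenvectorBasis rfl i]

/-- In an eigenbasis the trace of `A²` is the sum of the squared eigenvalues. This turns the
vanishing of one scalar into the vanishing of an operator. -/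
theorem eq_zero_of_symmetric_of_trace_sq [FiniteDimensional ℝ V] (g : V →ₗ[ℝ] V →ₗ[ℝ] ℝ)
    (hs : ∀ u v, g u v = g v u) (hp : ∀ u, u ≠ 0 → 0 < g u u) (A : V →ₗ[ℝ] V)
    (hA : ∀ u v, g (A u) v = g u (A v)) (htr : LinearMap.trace ℝ V (A * A) = 0) : A = 0 := by
  obtain ⟨b, μ, hb⟩ := exists_eigenbasis_of_symmetric g hs hp A hA
  have h1 : LinearMap.trace ℝ V (A * A) = ∑ i, μ i ^ 2 := by
    rw [LinearMap.trace_eq_matrix_trace ℝ b, Matrix.trace]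
    refine Finset.sum_congr rfl fun i _ ↦ ?_
    simp [LinearMap.toMatrix_apply, hb, sq]
  rw [h1, Finset.sum_eq_zero_iff_of_nonneg fun i _ ↦ sq_nonneg _] at htr
  refine b.ext fun i ↦ ?_
  have : μ i = 0 := by simpa using htr i (Finset.mem_univ i)
  simp [hb, this]

/-- Collecting the eigenvalues in a `Finset` discards multiplicities; the product still kills `A`
because `A` is diagonalizable. -/
theorem exists_finset_aeval_prod_eq_zero [FiniteDimensional ℝ V] (g : V →ₗ[ℝ] V →ₗ[ℝ] ℝ)
    (hs : ∀ u v, g u v = g v u) (hp : ∀ u, u ≠ 0 → 0 < g u u) (A : V →ₗ[ℝ] V)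
    (hA : ∀ u v, g (A u) v = g u (A v)) (hpos : ∀ u, u ≠ 0 → 0 < g (A u) u) :
    ∃ s : Finset ℝ, (∀ a ∈ s, 0 < a) ∧ aeval A (∏ a ∈ s, (X - C a)) = 0 := by
  obtain ⟨b, μ, hb⟩ := exists_eigenbasis_of_symmetric g hs hp A hA
  refine ⟨Finset.univ.image μ, fun a ha ↦ ?_, b.ext fun i ↦ ?_⟩
  · obtain ⟨i, -, rfl⟩ := Finset.mem_image.1 ha
    have h1 := hpos (b i) (b.ne_zero i)
    rw [hb, map_smul, LinearMap.smul_apply, smul_eq_mul] at h1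
    exact pos_of_mul_pos_left h1 (hp _ (b.ne_zero i)).le
  · rw [Module.End.aeval_apply_of_hasEigenvector (f := A) (μ := μ i)
      ⟨Module.End.mem_eigenspace_iff.2 (hb i), b.ne_zero i⟩]
    have : eval (μ i) (∏ a ∈ Finset.univ.image μ, (X - C a)) = 0 := by
      rw [eval_prod]
      exact Finset.prod_eq_zero (Finset.mem_image_of_mem μ (Finset.mem_univ i)) (by simp)
    simp [this]

/-- If the square of a map `S` that is positive for `g` is annihilated by `∏ (X - a)` with `a > 0`,
then `S` is annihilated by `∏ (X - √a)`. -/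
theorem aeval_prod_sqrt_eq_zero (g : V →ₗ[ℝ] V →ₗ[ℝ] ℝ) (hp : ∀ u, u ≠ 0 → 0 < g u u)
    (S : V →ₗ[ℝ] V) (hS : ∀ u, u ≠ 0 → 0 < g (S u) u) (s : Finset ℝ) (hs : ∀ a ∈ s, 0 < a)
    (h : aeval (S * S) (∏ a ∈ s, (X - C a)) = 0) :
    aeval S (∏ a ∈ s.image Real.sqrt, (X - C a)) = 0 := by
  -- `S + √a` is positive for `g`, so it has no kernel.
  have hinj : ∀ a ∈ s, Function.Injective (aeval S (X + C (Real.sqrt a))) := fun a _ ↦ by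
    rw [injective_iff_map_eq_zero]
    intro u hu
    by_contra hu0
    have h1 : g (S u) u + Real.sqrt a * g u u = 0 := by
      have := congrArg (fun w ↦ g w u) hu
      simpa [Algebra.algebraMap_eq_smul_one] using this
    have := hS u hu0
    have := mul_nonneg (Real.sqrt_nonneg a) (hp u hu0).le
    linarith
  have hinj' : Function.Injective (aeval S (∏ a ∈ s, (X + C (Real.sqrt a)))) := by
    clear h hs
    induction s using Finset.induction_on with
    | empty => simpa [Module.End.one_eq_id] using Function.injective_id
    | insert a t ha ih =>
      rw [Finset.prod_insert ha, map_mul, Module.End.coe_mul]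
      exact (hinj a (Finset.mem_insert_self _ _)).comp
        (ih fun b hb ↦ hinj b (Finset.mem_insert_of_mem hb))
  -- `X² - a = (X + √a)(X - √a)`; the injective factors `S + √a` can then be cancelled.
  have hfac : (∏ a ∈ s, (X - C a)).comp (X * X : ℝ[X]) =
      (∏ a ∈ s, (X + C (Real.sqrt a))) * ∏ a ∈ s.image Real.sqrt, (X - C a) := by
    rw [Finset.prod_image, ← Finset.prod_mul_distrib, Polynomial.prod_comp]
    · refine Finset.prod_congr rfl fun a ha ↦ ?_
      have : C a = C (Real.sqrt a) * C (Real.sqrt a) := by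
        rw [← C_mul, Real.mul_self_sqrt (hs a ha).le]
      simp only [sub_comp, X_comp, C_comp]
      rw [this]
      ring
    · intro a ha b hb hab
      exact (Real.sqrt_inj (hs a ha).le (hs b hb).le).1 hab
  have h1 : aeval S ((∏ a ∈ s, (X - C a)).comp (X * X : ℝ[X])) = 0 := by
    rw [aeval_comp]
    simpa using h
  rw [hfac, map_mul] at h1
  ext u
  apply hinj'
  have := LinearMap.congr_fun h1 u
  simpa using this

theorem prod_X_sub_C_dvd_of_eval_eq_zero (s : Finset ℝ) (p : ℝ[X]) (h : ∀ a ∈ s, eval a p = 0) :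
    ∏ a ∈ s, (X - C a) ∣ p :=
  Finset.prod_dvd_of_coprime
    (fun _ _ _ _ hab ↦ pairwise_coprime_X_sub_C (s := id) Function.injective_id hab)
    fun a ha ↦ dvd_iff_isRoot.2 (h a ha)

/-- Interpolate the values `a⁻¹` at the nodes `a²`, which are distinct because `s` is positive. For
`S` annihilated by the product this gives `S⁻¹ = r(S²)`: the inverse is a polynomial in `S²`, which
for the polar factor is `-R²`. -/
theorem exists_dvd_X_mul_comp_sub_one (s : Finset ℝ) (hs : ∀ a ∈ s, 0 < a) :
    ∃ r : ℝ[X], ∏ a ∈ s, (X - C a) ∣ X * r.comp (X * X) - 1 := by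
  have hinj : Set.InjOn (fun a : ℝ ↦ a * a) s := fun a ha b hb hab ↦ by
    have := hs a ha
    have := hs b hb
    exact (mul_self_inj (by positivity) (by positivity)).1 hab
  refine ⟨Lagrange.interpolate s (fun a ↦ a * a) (fun a ↦ a⁻¹),
    prod_X_sub_C_dvd_of_eval_eq_zero s _ fun a ha ↦ ?_⟩
  have h1 := Lagrange.eval_interpolate_at_node (fun a : ℝ ↦ a⁻¹) hinj ha
  simp only [eval_sub, eval_mul, eval_X, eval_comp, eval_one]
  rw [h1, mul_inv_cancel₀ (hs a ha).ne', sub_self]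

end Algebra

end AlmostSymplectic

namespace AlmostSymplectic

/-! ### Smooth fields of endomorphisms. -/

section Smoothness

variable {E : Type*} [NormedAddCommGroup E] [NormedSpace ℝ E]
  {H : Type*} [TopologicalSpace H] {I : ModelWithCorners ℝ E H}
  {M : Type*} [TopologicalSpace M] [ChartedSpace H M]
  [IsManifold I ∞ M]

/-- The endomorphism field `A` read in the trivialization of the tangent bundle at `x₀`. -/
def coordEnd (I : ModelWithCorners ℝ E H) [IsManifold I ∞ M] (x₀ : M) (A : EndField I M) :
    M → E →L[ℝ] E := fun x ↦
  ContinuousLinearMap.inCoordinates E (fun x : M ↦ TangentSpace I x) E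
    (fun x : M ↦ TangentSpace I x) x₀ x x₀ x (A x)

theorem smoothEnd_iff {A : EndField I M} :
    SmoothEnd I A ↔ ∀ x₀, ContMDiffAt I 𝓘(ℝ, E →L[ℝ] E) ∞ (coordEnd I x₀ A) x₀ := by
  refine forall_congr' fun x₀ ↦ ?_
  rw [contMDiffAt_hom_bundle]
  exact and_iff_right contMDiffAt_id

theorem coordEnd_eq (A : EndField I M) {x₀ x : M}
    (hx : x ∈ (trivializationAt E (TangentSpace I) x₀).baseSet) :
    coordEnd I x₀ A x =
      (((trivializationAt E (TangentSpace I) x₀).continuousLinearEquivAt ℝ x hx :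
        TangentSpace I x →L[ℝ] E)).comp ((A x).comp
        (((trivializationAt E (TangentSpace I) x₀).continuousLinearEquivAt ℝ x hx).symm :
          E →L[ℝ] TangentSpace I x)) :=
  ContinuousLinearMap.inCoordinates_eq hx hx

theorem eventually_mem_baseSet (x₀ : M) :
    ∀ᶠ x in nhds x₀, x ∈ (trivializationAt E (TangentSpace I) x₀).baseSet :=
  (trivializationAt E (TangentSpace I) x₀).open_baseSet.mem_nhds
    (FiberBundle.mem_baseSet_trivializationAt E (TangentSpace I) x₀)

theorem SmoothEnd.mul {A B : EndField I M} (hA : SmoothEnd I A) (hB : SmoothEnd I B) :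
    SmoothEnd I (fun x ↦ A x * B x) := by
  rw [smoothEnd_iff] at hA hB ⊢
  intro x₀
  refine ((hA x₀).clm_comp (hB x₀)).congr_of_eventuallyEq ?_
  filter_upwards [eventually_mem_baseSet (I := I) x₀] with x hx
  rw [coordEnd_eq _ hx, coordEnd_eq _ hx, coordEnd_eq _ hx]
  generalize (trivializationAt E (TangentSpace I) x₀).continuousLinearEquivAt ℝ x hx = e
  ext u
  simp

theorem smoothEnd_one : SmoothEnd I (fun _ ↦ 1 : EndField I M) := by
  rw [smoothEnd_iff]
  intro x₀
  refine (contMDiffAt_const (c := (1 : E →L[ℝ] E))).congr_of_eventuallyEq ?_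
  filter_upwards [eventually_mem_baseSet (I := I) x₀] with x hx
  rw [coordEnd_eq _ hx]
  generalize (trivializationAt E (TangentSpace I) x₀).continuousLinearEquivAt ℝ x hx = e
  ext u
  simp

theorem SmoothEnd.add {A B : EndField I M} (hA : SmoothEnd I A) (hB : SmoothEnd I B) :
    SmoothEnd I (fun x ↦ A x + B x) :=
  ContMDiff.add_section hA hB

theorem SmoothEnd.const_smul {A : EndField I M} (c : ℝ) (hA : SmoothEnd I A) :
    SmoothEnd I (fun x ↦ c • A x) :=
  ContMDiff.const_smul_section hA

/-- The field of endomorphisms `p(R)`, for a polynomial `p` with constant coefficients. -/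
def polyEnd (R : EndField I M) (p : Polynomial ℝ) : EndField I M :=
  fun x ↦ Polynomial.aeval (R x) p

theorem SmoothEnd.polyEnd {R : EndField I M} (hR : SmoothEnd I R) (p : Polynomial ℝ) :
    SmoothEnd I (polyEnd R p) := by
  induction p using Polynomial.induction_on' with
  | add p q hp hq =>
    convert hp.add hq using 1
    funext x
    simp [AlmostSymplectic.polyEnd]
  | monomial n a =>
    have h : SmoothEnd I (fun x ↦ R x ^ n) := by
      induction n with
      | zero => simpa using smoothEnd_one
      | succ n ih => simpa only [pow_succ] using ih.mul hR
    convert h.const_smul a using 1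
    funext x
    simp [AlmostSymplectic.polyEnd, Polynomial.aeval_monomial, Algebra.smul_def]

theorem SmoothEnd.smoothFieldOn {A : EndField I M} (hA : SmoothEnd I A) {X : VField I M} {U : Set M}
    (hX : SmoothFieldOn I X U) : SmoothFieldOn I (applyField I A X) U :=
  ContMDiffOn.clm_bundle_apply (F₁ := E) (F₂ := E) (E₁ := fun x : M ↦ TangentSpace I x)
    (E₂ := fun x : M ↦ TangentSpace I x) (b := fun x : M ↦ x) (ϕ := A) (v := X)
    hA.contMDiffOn hX

theorem SmoothFieldOn.mdifferentiableAt {X : VField I M} {U : Set M} (hX : SmoothFieldOn I X U)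
    (hU : IsOpen U) {x : M} (hx : x ∈ U) :
    MDifferentiableAt I I.tangent (fun x ↦ (⟨x, X x⟩ : TangentBundle I M)) x :=
  ((hX x hx).contMDiffAt (hU.mem_nhds hx)).mdifferentiableAt (by simp)

/-- If `g(u, v) = κ(R u, v)` with `g`, `κ` smooth and `κ` nondegenerate, then `R` is smooth. -/
theorem smoothEnd_of_form_eq [FiniteDimensional ℝ E] (κ : AlmostSymplecticForm I M)
    {β : BilinField I M}
    (hβ : ContMDiff I (I.prod 𝓘(ℝ, E →L[ℝ] E →L[ℝ] ℝ)) ∞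
      (fun x ↦ TotalSpace.mk' (E →L[ℝ] E →L[ℝ] ℝ)
        (E := fun x : M ↦ TangentSpace I x →L[ℝ] TangentSpace I x →L[ℝ] ℝ) x (β x)))
    {R : EndField I M} (hR : ∀ x u v, β x u v = κ.form x (R x u) v) : SmoothEnd I R := by
  rw [smoothEnd_iff]
  intro x₀
  have hκ := κ.contMDiff x₀
  replace hβ := hβ x₀
  rw [contMDiffAt_hom_bundle] at hκ hβ
  replace hκ := hκ.2
  replace hβ := hβ.2
  set k : M → E →L[ℝ] E →L[ℝ] ℝ := fun x ↦ ContinuousLinearMap.inCoordinates E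
    (fun x : M ↦ TangentSpace I x) (E →L[ℝ] ℝ) (fun x : M ↦ TangentSpace I x →L[ℝ] ℝ)
    x₀ x x₀ x (κ.form x) with hk
  set b : M → E →L[ℝ] E →L[ℝ] ℝ := fun x ↦ ContinuousLinearMap.inCoordinates E
    (fun x : M ↦ TangentSpace I x) (E →L[ℝ] ℝ) (fun x : M ↦ TangentSpace I x →L[ℝ] ℝ)
    x₀ x x₀ x (β x) with hb
  have hmem : ∀ {x : M}, x ∈ (trivializationAt E (TangentSpace I) x₀).baseSet →
      x ∈ (trivializationAt (E →L[ℝ] ℝ) (fun x : M ↦ TangentSpace I x →L[ℝ] ℝ) x₀).baseSet :=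
    fun {x} hx ↦ by simpa using hx
  -- Nondegeneracy and equality of dimensions make `k x` invertible; `R` then reads as `(k x)⁻¹ ∘ b
  -- x`, and inversion is smooth at invertible maps.
  have hinj : ∀ x, x ∈ (trivializationAt E (TangentSpace I) x₀).baseSet →
      ∃ e : E ≃L[ℝ] (E →L[ℝ] ℝ), (e : E →L[ℝ] E →L[ℝ] ℝ) = k x := by
    intro x hx
    have h1 : Function.Injective (k x) := by
      rw [hk]
      simp only
      rw [ContinuousLinearMap.inCoordinates_eq hx (hmem hx)]
      generalize (trivializationAt E (TangentSpace I) x₀).continuousLinearEquivAt ℝ x hx = e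
      generalize (trivializationAt (E →L[ℝ] ℝ) (fun x : M ↦ TangentSpace I x →L[ℝ] ℝ)
        x₀).continuousLinearEquivAt ℝ x (hmem hx) = e'
      have h2 : Function.Injective (κ.form x) := by
        rw [injective_iff_map_eq_zero]
        intro u hu
        exact κ.nondegenerate x u fun v ↦ by simp [hu]
      intro u v huv
      have h4 : κ.form x (e.symm u) = κ.form x (e.symm v) := by simpa using huv
      exact e.symm.injective (h2 h4)
    have h3 : Module.finrank ℝ E = Module.finrank ℝ (E →L[ℝ] ℝ) := by
      rw [← (LinearMap.toContinuousLinearMap (𝕜 := ℝ) (E := E) (F' := ℝ)).finrank_eq]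
      exact Subspace.dual_finrank_eq.symm
    exact ⟨(LinearEquiv.ofInjectiveOfFinrankEq (k x : E →ₗ[ℝ] E →L[ℝ] ℝ) h1
      h3).toContinuousLinearEquiv, by ext; rfl⟩
  have hinv : ContMDiffAt I 𝓘(ℝ, (E →L[ℝ] ℝ) →L[ℝ] E) ∞
      (fun x ↦ ContinuousLinearMap.inverse (k x)) x₀ := by
    obtain ⟨e, he⟩ := hinj x₀ (FiberBundle.mem_baseSet_trivializationAt E (TangentSpace I) x₀)
    have : ContDiffAt ℝ ∞ (ContinuousLinearMap.inverse : (E →L[ℝ] E →L[ℝ] ℝ) → _) (k x₀) := by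
      rw [← he]
      exact contDiffAt_map_inverse e
    exact this.contMDiffAt.comp x₀ hκ
  refine (hinv.clm_comp hβ).congr_of_eventuallyEq ?_
  filter_upwards [eventually_mem_baseSet (I := I) x₀] with x hx
  obtain ⟨e, he⟩ := hinj x hx
  have hfac : b x = (k x).comp (coordEnd I x₀ R x) := by
    have hx' := hmem hx
    rw [hk, hb]
    simp only
    rw [ContinuousLinearMap.inCoordinates_eq hx hx', ContinuousLinearMap.inCoordinates_eq hx hx',
      coordEnd_eq _ hx]
    generalize (trivializationAt E (TangentSpace I) x₀).continuousLinearEquivAt ℝ x hx = e₁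
    have : β x = (κ.form x).comp (R x) := by
      ext u v
      exact hR x u v
    rw [this]
    ext u v
    simp
  rw [hfac, ← he]
  ext u
  simp

end Smoothness

/-! ### Polynomials in a Nijenhuis operator. -/

section Nijenhuis

variable {E : Type*} [NormedAddCommGroup E] [NormedSpace ℝ E] [CompleteSpace E]
  {H : Type*} [TopologicalSpace H] {I : ModelWithCorners ℝ E H}
  {M : Type*} [TopologicalSpace M] [ChartedSpace H M]
  [IsManifold I ∞ M]

omit [CompleteSpace E] in
variable (I M) in
theorem isManifold_two : IsManifold I 2 M :=
  .of_le (n := ∞) (WithTop.coe_le_coe.2 le_top)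

/-- The mixed Nijenhuis expression of two fields of endomorphisms vanishes. -/
def NijenhuisPairZero (A B : EndField I M) : Prop :=
  ∀ (U : Set M), IsOpen U → ∀ X Y : VField I M, SmoothFieldOn I X U → SmoothFieldOn I Y U →
    ∀ x ∈ U, mlieBracket I (applyField I A X) (applyField I B Y) x
      + A x (B x (mlieBracket I X Y x))
      - A x (mlieBracket I X (applyField I B Y) x)
      - B x (mlieBracket I (applyField I A X) Y x) = 0

omit [CompleteSpace E] in
theorem nijenhuisPairZero_self_iff {A : EndField I M} :
    NijenhuisPairZero A A ↔ NijenhuisZero I A := by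
  refine forall₂_congr fun U hU ↦ forall₂_congr fun X Y ↦ forall₂_congr fun hX hY ↦
    forall₂_congr fun x hx ↦ ?_
  rw [nijenhuis, sub_right_comm]

omit [CompleteSpace E] in
theorem nijenhuisPairZero_one_left (B : EndField I M) :
    NijenhuisPairZero (fun _ ↦ 1) B := by
  intro U hU X Y hX hY x hx
  have h : applyField I (fun _ ↦ 1) X = X := rfl
  simp [h]

omit [CompleteSpace E] in
-- Writing `N_{A,B}` for the mixed expression, `N_{AA',B}(X, Y) = N_{A,B}(A'X, Y) + A N_{A',B}(X,
-- Y)`. No commutation is needed, which is why the two slots are kept apart.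
theorem NijenhuisPairZero.mul_left {A A' B : EndField I M} (hA' : SmoothEnd I A')
    (h : NijenhuisPairZero A B) (h' : NijenhuisPairZero A' B) :
    NijenhuisPairZero (fun x ↦ A x * A' x) B := by
  intro U hU X Y hX hY x hx
  have h1 := h U hU (applyField I A' X) Y (hA'.smoothFieldOn hX) hY x hx
  have h2 := congrArg (A x) (h' U hU X Y hX hY x hx)
  have h3 : applyField I (fun x ↦ A x * A' x) X = applyField I A (applyField I A' X) := rfl
  have h4 : ∀ v, (A x * A' x) v = A x (A' x v) := fun v ↦ rfl
  simp only [map_add, map_sub, map_zero, h3, h4] at h2 ⊢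
  rw [← add_zero (0 : TangentSpace I x)]
  nth_rewrite 1 [← h1]
  rw [← h2]
  abel

theorem NijenhuisPairZero.add_left {A A' B : EndField I M} (hA : SmoothEnd I A)
    (hA' : SmoothEnd I A') (h : NijenhuisPairZero A B) (h' : NijenhuisPairZero A' B) :
    NijenhuisPairZero (fun x ↦ A x + A' x) B := by
  have : IsManifold I 2 M := isManifold_two I M
  intro U hU X Y hX hY x hx
  have h1 := h U hU X Y hX hY x hx
  have h2 := h' U hU X Y hX hY x hx
  have h3 : applyField I (fun x ↦ A x + A' x) X = applyField I A X + applyField I A' X := rfl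
  have dA := (hA.smoothFieldOn hX).mdifferentiableAt hU hx
  have dA' := (hA'.smoothFieldOn hX).mdifferentiableAt hU hx
  rw [h3, mlieBracket_add_left dA dA', mlieBracket_add_left dA dA']
  simp only [map_add, add_apply]
  rw [← add_zero (0 : TangentSpace I x)]
  nth_rewrite 1 [← h1]
  rw [← h2]
  abel

theorem NijenhuisPairZero.const_smul_left {A B : EndField I M} (c : ℝ) (hA : SmoothEnd I A)
    (h : NijenhuisPairZero A B) : NijenhuisPairZero (fun x ↦ c • A x) B := by
  have : IsManifold I 2 M := isManifold_two I M
  intro U hU X Y hX hY x hx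
  have h1 := h U hU X Y hX hY x hx
  have h3 : applyField I (fun x ↦ c • A x) X = c • applyField I A X := rfl
  have dA := (hA.smoothFieldOn hX).mdifferentiableAt hU hx
  rw [h3, mlieBracket_const_smul_left dA, mlieBracket_const_smul_left dA]
  simp only [map_smul, smul_apply, ← smul_add, ← smul_sub, h1, smul_zero]

omit [CompleteSpace E] in
-- Antisymmetry of the bracket exchanges the slots, except for the term `AB[X, Y]`, where
-- commutation enters.
theorem NijenhuisPairZero.symm {A B : EndField I M} (hAB : ∀ x, Commute (A x) (B x))
    (h : NijenhuisPairZero A B) : NijenhuisPairZero B A := by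
  intro U hU X Y hX hY x hx
  have h1 := h U hU Y X hY hX x hx
  have h2 : ∀ v, B x (A x v) = A x (B x v) := fun v ↦ (DFunLike.congr_fun (hAB x) v).symm
  rw [mlieBracket_swap_apply, mlieBracket_swap_apply (V := X) (W := Y),
    mlieBracket_swap_apply (V := X), mlieBracket_swap_apply (W := Y), h2]
  simp only [map_neg]
  rw [← neg_eq_zero, ← h1]
  abel

theorem NijenhuisPairZero.polyEnd_left {R B : EndField I M} (hR : SmoothEnd I R)
    (h : NijenhuisPairZero R B) (p : Polynomial ℝ) : NijenhuisPairZero (polyEnd R p) B := by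
  induction p using Polynomial.induction_on' with
  | add p q hp hq =>
    convert hp.add_left (hR.polyEnd p) (hR.polyEnd q) hq using 1
    funext x
    simp [polyEnd]
  | monomial n a =>
    have h : NijenhuisPairZero (fun x ↦ R x ^ n) B := by
      induction n with
      | zero => simpa using nijenhuisPairZero_one_left B
      | succ n ih => simpa only [pow_succ] using ih.mul_left hR h
    have hs : SmoothEnd I (fun x ↦ R x ^ n) := by
      convert hR.polyEnd (Polynomial.X ^ n) using 1
      funext x
      simp [polyEnd]
    convert h.const_smul_left a hs using 1
    funext x
    simp [polyEnd, Polynomial.aeval_monomial, Algebra.smul_def]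

/-- Polynomials with constant coefficients in a Nijenhuis operator are Nijenhuis operators. -/
theorem NijenhuisZero.polyEnd {R : EndField I M} (hR : SmoothEnd I R)
    (h : NijenhuisZero I R) (p : Polynomial ℝ) : NijenhuisZero I (polyEnd R p) := by
  rw [← nijenhuisPairZero_self_iff] at h ⊢
  -- From `(R, R)` to `(p(R), R)`, then to `(R, p(R))` by symmetry, then to `(p(R), p(R))`.
  refine ((h.polyEnd_left hR p).symm fun x ↦ ?_).polyEnd_left hR p
  exact Polynomial.aeval_X (R := ℝ) (R x) ▸
    (Commute.all p Polynomial.X).map (Polynomial.aeval (R x))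

end Nijenhuis

/-! ### Brackets and the Nijenhuis tensor in a chart. -/

section Coordinates

variable {E : Type*} [NormedAddCommGroup E] [NormedSpace ℝ E]
  {H : Type*} [TopologicalSpace H] {I : ModelWithCorners ℝ E H}
  {M : Type*} [TopologicalSpace M] [ChartedSpace H M]
  [IsManifold I ∞ M]

/-- The vector field that reads as `f` in the chart at `x₀`. -/
def coordField (I : ModelWithCorners ℝ E H) [IsManifold I ∞ M] (x₀ : M) (f : M → E) : VField I M :=
  fun x ↦ (trivializationAt E (TangentSpace I) x₀).symmL ℝ x (f x)

theorem mfderiv_extChartAt_self (x₀ : M) (v : TangentSpace I x₀) :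
    mfderiv I 𝓘(ℝ, E) (extChartAt I x₀) x₀ v = v := by
  rw [← TangentBundle.continuousLinearMapAt_trivializationAt (mem_chart_source H x₀),
    TangentBundle.continuousLinearMapAt_trivializationAt_eq_core (mem_chart_source H x₀)]
  exact (tangentBundleCore I M).coordChange_self _ _ (mem_chart_source H x₀) v

theorem coordField_self (x₀ : M) (f : M → E) : coordField I x₀ f x₀ = f x₀ := by
  rw [coordField, TangentBundle.symmL_trivializationAt_eq_core (mem_chart_source H x₀)]
  exact (tangentBundleCore I M).coordChange_self _ _ (mem_chart_source H x₀) (f x₀)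

theorem mpullbackWithin_coordField (x₀ : M) (f : M → E) {y : E}
    (hy : y ∈ (extChartAt I x₀).target) :
    mpullbackWithin 𝓘(ℝ, E) I (extChartAt I x₀).symm (coordField I x₀ f) (Set.range I) y =
      f ((extChartAt I x₀).symm y) := by
  rw [mpullbackWithin_apply, coordField, TangentBundle.symmL_trivializationAt
    (by simpa using (extChartAt I x₀).map_target hy), (extChartAt I x₀).right_inv hy]
  obtain ⟨e, he⟩ := isInvertible_mfderivWithin_extChartAt_symm hy
  rw [← he, ContinuousLinearMap.inverse_equiv]
  exact e.symm_apply_apply _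

/-- The fields pull back to `f` and `h` under the inverse chart, and the derivative of the chart at
its own centre `x₀` is the identity; what remains is the bracket in a vector space. -/
theorem mlieBracket_coordField (x₀ : M) {f h : M → E} {f' h' : E →L[ℝ] E}
    (hf : HasMFDerivAt I 𝓘(ℝ, E) f x₀ f') (hh : HasMFDerivAt I 𝓘(ℝ, E) h x₀ h') :
    mlieBracket I (coordField I x₀ f) (coordField I x₀ h) x₀ = h' (f x₀) - f' (h x₀) := by
  have hev : ∀ f : M → E, mpullbackWithin 𝓘(ℝ, E) I (extChartAt I x₀).symm
      (coordField I x₀ f) (Set.range I) =ᶠ[nhdsWithin (extChartAt I x₀ x₀) (Set.range I)]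
        (f ∘ (extChartAt I x₀).symm) := fun f ↦ by
    filter_upwards [extChartAt_target_mem_nhdsWithin x₀] with y hy
    exact mpullbackWithin_coordField x₀ f hy
  have hx := mem_extChartAt_target (I := I) x₀
  have hd : ∀ (f : M → E) (f' : E →L[ℝ] E), HasMFDerivAt I 𝓘(ℝ, E) f x₀ f' →
      fderivWithin ℝ (f ∘ (extChartAt I x₀).symm) (Set.range I) (extChartAt I x₀ x₀) = f' :=
    fun f f' hf ↦ HasFDerivWithinAt.fderivWithin hf.2
      (I.uniqueDiffOn _ (extChartAt_target_subset_range x₀ hx))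
  rw [← mlieBracketWithin_univ, mlieBracketWithin_apply]
  rw [Set.preimage_univ, Set.univ_inter]
  rw [Filter.EventuallyEq.lieBracketWithin_vectorField_eq (hev f)
    (mpullbackWithin_coordField x₀ f hx) (hev h) (mpullbackWithin_coordField x₀ h hx),
    lieBracketWithin, hd f f' hf, hd h h' hh]
  have hc := mfderiv_extChartAt_self (I := I) x₀
  obtain ⟨e, he⟩ := isInvertible_mfderiv_extChartAt (mem_extChartAt_source (I := I) x₀)
  rw [← he] at hc ⊢
  rw [ContinuousLinearMap.inverse_equiv]
  refine e.injective ((e.apply_symm_apply _).trans ?_)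
  refine Eq.trans ?_ (hc _).symm
  simp
  rfl

theorem smoothFieldOn_coordField_const (x₀ : M) (u : E) :
    SmoothFieldOn I (coordField I x₀ fun _ ↦ u)
      (trivializationAt E (TangentSpace I) x₀).baseSet := by
  have h := (trivializationAt E (TangentSpace I) x₀).contMDiffOn_symm (IB := I) (n := ∞)
  have h2 : ContMDiffOn I (I.prod 𝓘(ℝ, E)) ∞ (fun x : M ↦ (x, u))
      (trivializationAt E (TangentSpace I) x₀).baseSet :=
    contMDiffOn_id.prodMk contMDiffOn_const
  refine (h.comp h2 fun x hx ↦ ?_).congr fun x hx ↦ ?_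
  · simpa [(trivializationAt E (TangentSpace I) x₀).target_eq] using hx
  · refine Eq.trans ?_ ((trivializationAt E (TangentSpace I) x₀).mk_symm hx u)
    rw [coordField, Trivialization.symmL_apply _ hx]

theorem coordEnd_self (A : EndField I M) (x₀ : M) (v : E) : coordEnd I x₀ A x₀ v = A x₀ v := by
  have h := coordField_self (I := I) x₀ (fun _ ↦ v)
  have h' : ∀ w : TangentSpace I x₀,
      (trivializationAt E (TangentSpace I) x₀).continuousLinearMapAt ℝ x₀ w = w := fun w ↦ by
    rw [TangentBundle.continuousLinearMapAt_trivializationAt (mem_chart_source H x₀)]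
    exact mfderiv_extChartAt_self x₀ w
  exact (h' _).trans (congrArg (A x₀) h)

theorem applyField_coordField_eventuallyEq (A : EndField I M) (x₀ : M) (u : E) :
    applyField I A (coordField I x₀ fun _ ↦ u) =ᶠ[nhds x₀]
      coordField I x₀ fun x ↦ coordEnd I x₀ A x u := by
  filter_upwards [eventually_mem_baseSet (I := I) x₀] with x hx
  exact ((trivializationAt E (TangentSpace I) x₀).symmL_continuousLinearMapAt hx _).symm

/-- The Nijenhuis tensor in a chart. -/
theorem NijenhuisZero.coord_eq_zero {R : EndField I M} (h : NijenhuisZero I R) (x₀ : M)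
    {D : E →L[ℝ] E →L[ℝ] E} (hD : HasMFDerivAt I 𝓘(ℝ, E →L[ℝ] E) (coordEnd I x₀ R) x₀ D)
    (u v : E) :
    D (coordEnd I x₀ R x₀ u) v - D (coordEnd I x₀ R x₀ v) u
      + coordEnd I x₀ R x₀ (D v u) - coordEnd I x₀ R x₀ (D u v) = 0 := by
  have h0 := h _ (trivializationAt E (TangentSpace I) x₀).open_baseSet _ _
    (smoothFieldOn_coordField_const x₀ u) (smoothFieldOn_coordField_const x₀ v) x₀
    (FiberBundle.mem_baseSet_trivializationAt E (TangentSpace I) x₀)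
  have hc : ∀ w : E, HasMFDerivAt I 𝓘(ℝ, E) (fun _ : M ↦ w) x₀ (0 : E →L[ℝ] E) :=
    fun w ↦ hasMFDerivAt_const w x₀
  have hR : ∀ w : E, HasMFDerivAt I 𝓘(ℝ, E) (fun x ↦ coordEnd I x₀ R x w) x₀
      ((ContinuousLinearMap.apply ℝ E w).comp D) := fun w ↦
    HasMFDerivAt.comp x₀ (ContinuousLinearMap.apply ℝ E w).hasMFDerivAt hD
  have ev := fun w ↦ applyField_coordField_eventuallyEq R x₀ w
  have b1 : mlieBracket I (applyField I R (coordField I x₀ fun _ ↦ u))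
      (applyField I R (coordField I x₀ fun _ ↦ v)) x₀ =
      (D (coordEnd I x₀ R x₀ u) v - D (coordEnd I x₀ R x₀ v) u : E) := by
    rw [(ev u).mlieBracket_vectorField_eq (ev v), mlieBracket_coordField x₀ (hR u) (hR v)]
    rfl
  have b2 : mlieBracket I (coordField I x₀ fun _ ↦ u) (coordField I x₀ fun _ ↦ v) x₀ =
      (0 : E) := by
    refine (mlieBracket_coordField x₀ (hc u) (hc v)).trans ?_
    exact (by simp : (0 : E →L[ℝ] E) u - (0 : E →L[ℝ] E) v = 0)
  have b3 : mlieBracket I (applyField I R (coordField I x₀ fun _ ↦ u))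
      (coordField I x₀ fun _ ↦ v) x₀ = (-(D v u) : E) := by
    refine ((ev u).mlieBracket_vectorField_eq (Filter.EventuallyEq.refl _ _)).trans
      ((mlieBracket_coordField x₀ (hR u) (hc v)).trans ?_)
    exact (by simp : (0 : E →L[ℝ] E) (coordEnd I x₀ R x₀ u) - D v u = -(D v u))
  have b4 : mlieBracket I (coordField I x₀ fun _ ↦ u)
      (applyField I R (coordField I x₀ fun _ ↦ v)) x₀ = (D u v : E) := by
    refine (Filter.EventuallyEq.mlieBracket_vectorField_eq (Filter.EventuallyEq.refl _ _)
      (ev v)).trans ((mlieBracket_coordField x₀ (hc u) (hR v)).trans ?_)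
    exact (by simp : D u v - (0 : E →L[ℝ] E) (coordEnd I x₀ R x₀ v) = D u v)
  rw [nijenhuis, b1, b2, b3, b4] at h0
  have h1 : (D (coordEnd I x₀ R x₀ u) v - D (coordEnd I x₀ R x₀ v) u : E)
      + coordEnd I x₀ R x₀ (coordEnd I x₀ R x₀ 0) - coordEnd I x₀ R x₀ (-(D v u))
      - coordEnd I x₀ R x₀ (D u v) = 0 := by
    rw [coordEnd_self R x₀ (-(D v u)), coordEnd_self R x₀ (D u v),
      coordEnd_self R x₀ (coordEnd I x₀ R x₀ 0), coordEnd_self R x₀ 0]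
    exact h0
  simpa using h1

end Coordinates

/-! ### Constancy of the traces of powers. -/

section Trace

variable {E : Type*} [NormedAddCommGroup E] [NormedSpace ℝ E]
  {H : Type*} [TopologicalSpace H] {I : ModelWithCorners ℝ E H}
  {M : Type*} [TopologicalSpace M] [ChartedSpace H M]
  [IsManifold I ∞ M]

theorem eq_of_hasMFDerivAt_zero [I.Boundaryless] [PreconnectedSpace M] {f : M → ℝ}
    (hf : ∀ x, HasMFDerivAt I 𝓘(ℝ, ℝ) f x (0 : TangentSpace I x →L[ℝ] ℝ)) (x y : M) :
    f x = f y := by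
  have hloc : IsLocallyConstant f := by
    rw [IsLocallyConstant.iff_eventually_eq]
    intro x
    obtain ⟨r, hr, hsub⟩ := Metric.isOpen_iff.1 (isOpen_extChartAt_target (I := I) x)
      (extChartAt I x x) (mem_extChartAt_target x)
    have hd : ∀ z ∈ Metric.ball (extChartAt I x x) r,
        HasFDerivAt (f ∘ (extChartAt I x).symm) (0 : E →L[ℝ] ℝ) z := by
      intro z hz
      have h1 : MDifferentiableAt 𝓘(ℝ, E) I (extChartAt I x).symm z :=
        ((contMDiffOn_extChartAt_symm (n := 1) x).contMDiffAt
          ((isOpen_extChartAt_target x).mem_nhds (hsub hz))).mdifferentiableAt one_ne_zero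
      have h2 := hasMFDerivAt_iff_hasFDerivAt.1 ((hf _).comp z h1.hasMFDerivAt)
      exact h2.congr_fderiv (ContinuousLinearMap.zero_comp _)
    have hb : Metric.ball (extChartAt I x x) r ∈ nhds (extChartAt I x x) :=
      Metric.ball_mem_nhds _ hr
    filter_upwards [(continuousAt_extChartAt (I := I) x).preimage_mem_nhds hb,
      extChartAt_source_mem_nhds (I := I) x] with y hy hys
    have h3 := Metric.isOpen_ball.is_const_of_fderiv_eq_zero
      (convex_ball (extChartAt I x x) r).isPreconnected
      (fun z hz ↦ (hd z hz).differentiableAt.differentiableWithinAt)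
      (fun z hz ↦ (hd z hz).fderiv) hy (Metric.mem_ball_self hr)
    rwa [Function.comp_apply, Function.comp_apply, (extChartAt I x).left_inv hys,
      (extChartAt I x).left_inv (mem_extChartAt_source x)] at h3
  exact hloc.apply_eq_of_isPreconnected isPreconnected_univ (Set.mem_univ x) (Set.mem_univ y)

variable [FiniteDimensional ℝ E]

variable (E) in
/-- The trace as a continuous linear functional. -/
def traceCLM : (E →L[ℝ] E) →L[ℝ] ℝ :=
  LinearMap.toContinuousLinearMap
    ((LinearMap.trace ℝ E).comp (ContinuousLinearMap.coeLM ℝ))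

theorem traceCLM_apply (A : E →L[ℝ] E) : traceCLM E A = LinearMap.trace ℝ E A := rfl

theorem traceCLM_mul_comm (A B : E →L[ℝ] E) : traceCLM E (A * B) = traceCLM E (B * A) :=
  LinearMap.trace_mul_comm ℝ (A : E →ₗ[ℝ] E) (B : E →ₗ[ℝ] E)

/-- Cyclicity of the trace makes all `k` terms of the noncommutative power rule equal. For `k = 0`
the truncated exponent is harmless, since the coefficient vanishes. -/
theorem hasFDerivAt_trace_pow (A : E →L[ℝ] E) (k : ℕ) :
    HasFDerivAt (fun A : E →L[ℝ] E ↦ traceCLM E (A ^ k))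
      ((k : ℝ) • (traceCLM E).comp (ContinuousLinearMap.mul ℝ (E →L[ℝ] E) (A ^ (k - 1)))) A := by
  have h1 := (traceCLM E).hasFDerivAt.comp A ((hasFDerivAt_id A).pow' k)
  refine h1.congr_fderiv ?_
  refine ContinuousLinearMap.ext fun B ↦ ?_
  have h2 : ∀ i ∈ Finset.range k,
      traceCLM E (A ^ (k - 1 - i) * B * A ^ i) = traceCLM E (A ^ (k - 1) * B) := by
    intro i hi
    have hi' := Finset.mem_range.1 hi
    rw [traceCLM_mul_comm, ← mul_assoc, ← pow_add]
    congr 3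
    omega
  have h3 := Finset.sum_congr rfl h2
  rw [Finset.sum_const, Finset.card_range, nsmul_eq_mul] at h3
  refine Eq.trans ?_ h3
  rw [ContinuousLinearMap.comp_apply, sum_apply, map_sum]
  rfl

theorem trace_pow_eq (A : EndField I M) (x₀ : M) (k : ℕ) {x : M}
    (hx : x ∈ (trivializationAt E (TangentSpace I) x₀).baseSet) :
    traceCLM E (coordEnd I x₀ A x ^ k) =
      LinearMap.trace ℝ (TangentSpace I x) ((A x : TangentSpace I x →ₗ[ℝ] TangentSpace I x) ^ k) := by
  rw [coordEnd_eq A hx]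
  generalize (trivializationAt E (TangentSpace I) x₀).continuousLinearEquivAt ℝ x hx = e
  rw [← LinearMap.trace_conj' _ e.toLinearEquiv, traceCLM_apply]
  congr 1
  have h1 : ∀ B : E →L[ℝ] E, ((B ^ k : E →L[ℝ] E) : E →ₗ[ℝ] E) = (B : E →ₗ[ℝ] E) ^ k :=
    fun B ↦ ContinuousLinearMap.toLinearMap_pow B k
  rw [h1]
  have h2 := map_pow (LinearEquiv.conjAlgEquiv ℝ e.toLinearEquiv)
    (A x : TangentSpace I x →ₗ[ℝ] TangentSpace I x) k
  exact h2.symm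

/-- The hypothesis says that `D(R₀u) - R₀ D(u)` is the commutator of `D.flip u` with `R₀`;
multiplied by a power of `R₀`, such a commutator is traceless. -/
theorem traceCLM_pow_mul_of_nijenhuis {R₀ : E →L[ℝ] E} {D : E →L[ℝ] E →L[ℝ] E}
    (h : ∀ u v, D (R₀ u) v - D (R₀ v) u + R₀ (D v u) - R₀ (D u v) = 0) (j : ℕ) (u : E) :
    traceCLM E (R₀ ^ j * D (R₀ u)) = traceCLM E (R₀ ^ (j + 1) * D u) := by
  have h1 : D (R₀ u) = D.flip u * R₀ - R₀ * D.flip u + R₀ * D u := by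
    ext v
    have := h u v
    change D (R₀ u) v = D (R₀ v) u - R₀ (D v u) + R₀ (D u v)
    rw [← sub_eq_zero, ← this]
    abel
  have h2 : traceCLM E (R₀ ^ j * (D.flip u * R₀)) = traceCLM E (R₀ ^ j * (R₀ * D.flip u)) := by
    rw [← mul_assoc, traceCLM_mul_comm, ← mul_assoc, ← mul_assoc, ← pow_succ, ← pow_succ']
  rw [h1, mul_add, mul_sub, map_add, map_sub, h2, sub_self, zero_add, ← mul_assoc, ← pow_succ]

/-- If `R` is a Nijenhuis operator and the traces of `R ^ (j + 1)` vanish, then the trace of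
`R ^ (j + 2)` is constant. -/
theorem NijenhuisZero.trace_pow_const [I.Boundaryless] [PreconnectedSpace M] {R : EndField I M}
    (hR : SmoothEnd I R) (hN : NijenhuisZero I R) (j : ℕ)
    (h0 : ∀ x, LinearMap.trace ℝ (TangentSpace I x)
      ((R x : TangentSpace I x →ₗ[ℝ] TangentSpace I x) ^ (j + 1)) = 0) (x y : M) :
    LinearMap.trace ℝ (TangentSpace I x)
      ((R x : TangentSpace I x →ₗ[ℝ] TangentSpace I x) ^ (j + 2)) =
    LinearMap.trace ℝ (TangentSpace I y)
      ((R y : TangentSpace I y →ₗ[ℝ] TangentSpace I y) ^ (j + 2)) := by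
  refine eq_of_hasMFDerivAt_zero (I := I) (f := fun x ↦ LinearMap.trace ℝ (TangentSpace I x)
      ((R x : TangentSpace I x →ₗ[ℝ] TangentSpace I x) ^ (j + 2))) (fun x₀ ↦ ?_) x y
  obtain ⟨D, hD⟩ : ∃ D : E →L[ℝ] E →L[ℝ] E,
      HasMFDerivAt I 𝓘(ℝ, E →L[ℝ] E) (coordEnd I x₀ R) x₀ D :=
    ⟨_, ((smoothEnd_iff.1 hR x₀).mdifferentiableAt (by simp)).hasMFDerivAt⟩
  set R₀ := coordEnd I x₀ R x₀ with hR₀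
  have hder : ∀ k : ℕ, HasMFDerivAt I 𝓘(ℝ, ℝ) (fun x ↦ LinearMap.trace ℝ (TangentSpace I x)
      ((R x : TangentSpace I x →ₗ[ℝ] TangentSpace I x) ^ k)) x₀
      (((k : ℝ) • (traceCLM E).comp
        (ContinuousLinearMap.mul ℝ (E →L[ℝ] E) (R₀ ^ (k - 1)))).comp D : E →L[ℝ] ℝ) := by
    intro k
    have h1 := HasMFDerivAt.comp x₀ (hasFDerivAt_trace_pow R₀ k).hasMFDerivAt hD
    refine h1.congr_of_eventuallyEq ?_
    filter_upwards [eventually_mem_baseSet (I := I) x₀] with x hx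
    exact (trace_pow_eq R x₀ k hx).symm
  have hzero : ((((j + 1 : ℕ) : ℝ) • (traceCLM E).comp
      (ContinuousLinearMap.mul ℝ (E →L[ℝ] E) (R₀ ^ (j + 1 - 1)))).comp D : E →L[ℝ] ℝ) = 0 := by
    have h1 := hder (j + 1)
    have h2 : HasMFDerivAt I 𝓘(ℝ, ℝ) (fun x ↦ LinearMap.trace ℝ (TangentSpace I x)
      ((R x : TangentSpace I x →ₗ[ℝ] TangentSpace I x) ^ (j + 1))) x₀
        (0 : TangentSpace I x₀ →L[ℝ] ℝ) := by
      exact (hasMFDerivAt_const (0 : ℝ) x₀).congr_of_eventuallyEq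
        (Filter.Eventually.of_forall h0)
    exact hasMFDerivAt_unique h1 h2
  have hfin := hder (j + 2)
  refine (congrArg (HasMFDerivAt I 𝓘(ℝ, ℝ) _ x₀) ?_).mp hfin
  refine ContinuousLinearMap.ext fun u ↦ ?_
  -- The derivative of `tr R^(j+1)` is tested on `R₀ u`, because the trace identity equates this, up
  -- to a nonzero factor, with the derivative of `tr R^(j+2)` along `u`.
  have h1 := DFunLike.congr_fun hzero (R₀ u)
  have h2 := traceCLM_pow_mul_of_nijenhuis (fun u v ↦ hN.coord_eq_zero x₀ hD u v) j u
  have h3 : ((j + 1 : ℕ) : ℝ) * traceCLM E (R₀ ^ j * D (R₀ u)) = 0 := h1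
  have h4 : traceCLM E (R₀ ^ j * D (R₀ u)) = 0 :=
    (mul_eq_zero.1 h3).resolve_left (by positivity)
  change ((j + 2 : ℕ) : ℝ) * traceCLM E (R₀ ^ (j + 1) * D u) = 0
  rw [← h2, h4, mul_zero]

end Trace

/-! ### Closedness of `κ(A·, ·)` by spectral decomposition. -/

section Closed

variable {E : Type*} [NormedAddCommGroup E] [NormedSpace ℝ E]
  {H : Type*} [TopologicalSpace H] {I : ModelWithCorners ℝ E H}
  {M : Type*} [TopologicalSpace M] [ChartedSpace H M]
  [IsManifold I ∞ M]

theorem AlmostSymplecticForm.swap (κ : AlmostSymplecticForm I M) (x : M) (u v : TangentSpace I x) :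
    κ.form x u v = - κ.form x v u := by
  have h := κ.alt x (u + v)
  simp only [map_add, add_apply, κ.alt] at h
  linarith

theorem AlmostSymplecticForm.mdifferentiableAt_pairing (κ : AlmostSymplecticForm I M)
    {X Y : VField I M} {U : Set M} (hU : IsOpen U) (hX : SmoothFieldOn I X U)
    (hY : SmoothFieldOn I Y U) {x : M} (hx : x ∈ U) :
    MDifferentiableAt I 𝓘(ℝ, ℝ) (fun y ↦ κ.form y (X y) (Y y)) x := by
  have h : MDifferentiableAt I (I.prod 𝓘(ℝ, ℝ))
      (fun m ↦ TotalSpace.mk' ℝ (E := Bundle.Trivial M ℝ) m (κ.form m (X m) (Y m))) x :=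
    MDifferentiableAt.clm_bundle_apply₂ (F₁ := E) (F₂ := E) (F₃ := ℝ)
      (E₁ := fun x : M ↦ TangentSpace I x) (E₂ := fun x : M ↦ TangentSpace I x)
      (E₃ := Bundle.Trivial M ℝ) (b := fun x : M ↦ x)
      ((κ.contMDiff x).mdifferentiableAt (by simp))
      (hX.mdifferentiableAt hU hx) (hY.mdifferentiableAt hU hx)
  exact ((mdifferentiableAt_totalSpace I _).1 h).2

/-- A field of bilinear forms is alternating, with differentiable values on smooth fields. -/
structure IsDiffAlternating (Ω : BilinField I M) : Prop where
  swap : ∀ x u v, Ω x u v = - Ω x v u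
  mdifferentiableAt : ∀ {X Y : VField I M} {U : Set M}, IsOpen U → SmoothFieldOn I X U →
    SmoothFieldOn I Y U → ∀ {x : M}, x ∈ U →
      MDifferentiableAt I 𝓘(ℝ, ℝ) (fun y ↦ Ω y (X y) (Y y)) x

theorem derivPairing_swap {Ω : BilinField I M} (hΩ : IsDiffAlternating Ω) (X Y Z : VField I M)
    (x : M) : derivPairing I Ω X Y Z x = - derivPairing I Ω X Z Y x := by
  have h : (fun y ↦ Ω y (Y y) (Z y)) = - fun y ↦ Ω y (Z y) (Y y) := by
    funext y
    exact hΩ.swap y _ _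
  rw [derivPairing, derivPairing, h, mfderiv_neg]
  rfl

theorem extDerivTwo_swap_left {Ω : BilinField I M} (hΩ : IsDiffAlternating Ω) (X Y Z : VField I M)
    (x : M) : extDerivTwo I Ω X Y Z x = - extDerivTwo I Ω Y X Z x := by
  rw [extDerivTwo, extDerivTwo, derivPairing_swap hΩ Z Y X, mlieBracket_swap_apply (V := Y) (W := X)]
  simp only [map_neg, neg_apply]
  ring

theorem extDerivTwo_swap_right {Ω : BilinField I M} (hΩ : IsDiffAlternating Ω) (X Y Z : VField I M)
    (x : M) : extDerivTwo I Ω X Y Z x = - extDerivTwo I Ω X Z Y x := by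
  rw [extDerivTwo, extDerivTwo, derivPairing_swap hΩ X Z Y, mlieBracket_swap_apply (V := Z) (W := Y)]
  simp only [map_neg, neg_apply]
  ring

theorem extDerivTwo_add_left [CompleteSpace E] {Ω : BilinField I M} (hΩ : IsDiffAlternating Ω)
    {X X' Y Z : VField I M} {U : Set M} (hU : IsOpen U) (hX : SmoothFieldOn I X U)
    (hX' : SmoothFieldOn I X' U) (hY : SmoothFieldOn I Y U) (hZ : SmoothFieldOn I Z U)
    {x : M} (hx : x ∈ U) :
    extDerivTwo I Ω (X + X') Y Z x = extDerivTwo I Ω X Y Z x + extDerivTwo I Ω X' Y Z x := by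
  have : IsManifold I 2 M := isManifold_two I M
  have h1 : derivPairing I Ω (X + X') Y Z x = derivPairing I Ω X Y Z x + derivPairing I Ω X' Y Z x :=
    map_add (mfderiv I 𝓘(ℝ, ℝ) (fun y ↦ Ω y (Y y) (Z y)) x) (X x) (X' x)
  have h2 : ∀ V W : VField I M, SmoothFieldOn I W U → derivPairing I Ω V (X + X') W x =
      derivPairing I Ω V X W x + derivPairing I Ω V X' W x := by
    intro V W hW
    have h : (fun y ↦ Ω y ((X + X') y) (W y)) =
        (fun y ↦ Ω y (X y) (W y)) + fun y ↦ Ω y (X' y) (W y) := by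
      funext y
      simp
    rw [derivPairing, h, mfderiv_add (hΩ.mdifferentiableAt hU hX hW hx)
      (hΩ.mdifferentiableAt hU hX' hW hx)]
    rfl
  have dX := hX.mdifferentiableAt hU hx
  have dX' := hX'.mdifferentiableAt hU hx
  rw [extDerivTwo, extDerivTwo, extDerivTwo, h1, h2 Y Z hZ, h2 Z Y hY,
    mlieBracket_add_left dX dX', mlieBracket_add_left dX dX']
  simp only [map_add, add_apply, Pi.add_apply]
  ring

/-- With constant eigenvalues the Nijenhuis condition becomes `(A - a)(A - b)[X, Y] = 0`. -/
theorem bracket_of_eigenfields [CompleteSpace E] {A : EndField I M} (hN : NijenhuisZero I A)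
    {X Y : VField I M}
    {U : Set M} (hU : IsOpen U) (hX : SmoothFieldOn I X U) (hY : SmoothFieldOn I Y U) {a b : ℝ}
    (ha : ∀ y, A y (X y) = a • X y) (hb : ∀ y, A y (Y y) = b • Y y) {x : M} (hx : x ∈ U) :
    A x (A x (mlieBracket I X Y x)) = (a + b) • A x (mlieBracket I X Y x) -
      (a * b) • mlieBracket I X Y x := by
  have : IsManifold I 2 M := isManifold_two I M
  have h := hN U hU X Y hX hY x hx
  have hA : applyField I A X = a • X := funext ha
  have hB : applyField I A Y = b • Y := funext hb
  have dX := hX.mdifferentiableAt hU hx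
  have dY := hY.mdifferentiableAt hU hx
  have dB : MDifferentiableAt I I.tangent (fun x ↦ (⟨x, (b • Y) x⟩ : TangentBundle I M)) x :=
    SmoothFieldOn.mdifferentiableAt (ContMDiffOn.const_smul_section hY) hU hx
  rw [nijenhuis, hA, hB, mlieBracket_const_smul_left dX, mlieBracket_const_smul_left dX,
    mlieBracket_const_smul_right dY, map_smul, map_smul] at h
  rw [← sub_eq_zero, ← h]
  module

/-- Moving `(A - a)(A - b)` across `κ` gives `(c - a)(c - b) κ(u, v) = 0`. -/
theorem pairing_bracket_eq_zero {V : Type*} [AddCommGroup V] [Module ℝ V]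
    [TopologicalSpace V] {κ : V →L[ℝ] V →L[ℝ] ℝ} {A : V →L[ℝ] V} (hA : ∀ u v, κ (A u) v = κ u (A v))
    {u v : V} {a b c : ℝ} (hu : A (A u) = (a + b) • A u - (a * b) • u)
    (hv : A v = c • v) (hca : c ≠ a) (hcb : c ≠ b) : κ u v = 0 := by
  have h1 := congrArg (fun w ↦ κ w v) hu
  simp only [map_sub, map_smul, sub_apply, smul_apply, hA, hv, smul_eq_mul] at h1
  have h2 : (c - a) * (c - b) * κ u v = 0 := by linear_combination h1
  simpa [sub_eq_zero, hca, hcb] using h2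

theorem pairing_eq_zero {V : Type*} [AddCommGroup V] [Module ℝ V]
    [TopologicalSpace V] {κ : V →L[ℝ] V →L[ℝ] ℝ} {A : V →L[ℝ] V} (hA : ∀ u v, κ (A u) v = κ u (A v))
    {u v : V} {a b : ℝ} (hu : A u = a • u) (hv : A v = b • v) (hab : a ≠ b) :
    κ u v = 0 := by
  have h1 := hA u v
  simp only [map_smul, smul_apply, hu, hv, smul_eq_mul] at h1
  have h2 : (a - b) * κ u v = 0 := by linear_combination h1
  simpa [sub_eq_zero, hab] using h2

variable {κ : AlmostSymplecticForm I M} {A : EndField I M}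

theorem extDerivTwo_eigenfields [CompleteSpace E] (hN : NijenhuisZero I A)
    (hA : ∀ x u v, κ.form x (A x u) v = κ.form x u (A x v)) (hκ : ClosedForm I κ.form)
    {X Y Z : VField I M} {U : Set M} (hU : IsOpen U) (hX : SmoothFieldOn I X U)
    (hY : SmoothFieldOn I Y U) (hZ : SmoothFieldOn I Z U) {a b c : ℝ}
    (ha : ∀ y, A y (X y) = a • X y) (hb : ∀ y, A y (Y y) = b • Y y)
    (hc : ∀ y, A y (Z y) = c • Z y) {x : M} (hx : x ∈ U) :
    extDerivTwo I (fun x ↦ (κ.form x).comp (A x)) X Y Z x = 0 := by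
  -- `μ` is a repeated eigenvalue among `a`, `b`, `c` if there is one. Every term of `dκ` in which
  -- no such coincidence occurs vanishes, and in the others `A` acts as `μ`, so `d(κ(A·, ·)) = μ dκ`
  -- on these fields.
  obtain ⟨μ, hμ1, hμ2, hμ3⟩ : ∃ μ : ℝ, (a = b → μ = a) ∧ (a = c → μ = a) ∧ (b = c → μ = b) := by
    by_cases h : a = b
    · exact ⟨a, by simp, by simp, by simp [h]⟩
    · exact ⟨c, fun h' ↦ absurd h' h, fun h' ↦ h'.symm, fun h' ↦ h'.symm⟩
  have hd : ∀ (V X Y : VField I M) (a b : ℝ), SmoothFieldOn I X U → SmoothFieldOn I Y U →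
      (∀ y, A y (X y) = a • X y) → (∀ y, A y (Y y) = b • Y y) → (a = b → μ = a) →
      derivPairing I (fun x ↦ (κ.form x).comp (A x)) V X Y x =
        μ * derivPairing I κ.form V X Y x := by
    intro V X Y a b hX hY ha hb hab
    have h : (fun y ↦ (κ.form y).comp (A y) (X y) (Y y)) =
        μ • fun y ↦ κ.form y (X y) (Y y) := by
      funext y
      by_cases h : a = b
      · simp [ha, hab h]
      · simp [ha, pairing_eq_zero (hA y) (ha y) (hb y) h]
    rw [derivPairing, derivPairing, h,
      const_smul_mfderiv (κ.mdifferentiableAt_pairing hU hX hY hx)]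
    rfl
  have hbr : ∀ (X Y Z : VField I M) (a b c : ℝ), SmoothFieldOn I X U → SmoothFieldOn I Y U →
      (∀ y, A y (X y) = a • X y) → (∀ y, A y (Y y) = b • Y y) → (∀ y, A y (Z y) = c • Z y) →
      (a = c → μ = c) → (b = c → μ = c) →
      (κ.form x).comp (A x) (mlieBracket I X Y x) (Z x) =
        μ * κ.form x (mlieBracket I X Y x) (Z x) := by
    intro X Y Z a b c hX hY ha hb hc hac hbc
    rw [ContinuousLinearMap.comp_apply, hA, hc, map_smul, smul_eq_mul]
    by_cases h1 : a = c
    · rw [hac h1]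
    by_cases h2 : b = c
    · rw [hbc h2]
    rw [pairing_bracket_eq_zero (hA x) (bracket_of_eigenfields hN hU hX hY ha hb hx) (hc x)
      (Ne.symm h1) (Ne.symm h2)]
    simp
  have h0 := hκ U hU X Y Z hX hY hZ x hx
  rw [extDerivTwo] at h0
  simp only [extDerivTwo]
  rw [hd X Y Z b c hY hZ hb hc hμ3, hd Y X Z a c hX hZ ha hc hμ2, hd Z X Y a b hX hY ha hb hμ1,
    hbr X Y Z a b c hX hY ha hb hc (by grind) (by grind),
    hbr X Z Y a c b hX hZ ha hc hb (by grind) (by grind),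
    hbr Y Z X b c a hY hZ hb hc ha (by grind) (by grind)]
  linear_combination μ * h0

open Polynomial in
/-- Let `A` be a Nijenhuis operator that is self-adjoint for the closed form `κ` and is annihilated
by a polynomial with constant coefficients and distinct real roots. Then `κ(A·, ·)` is closed. -/
theorem closedForm_comp [CompleteSpace E] (hs : SmoothEnd I A) (hN : NijenhuisZero I A)
    (hA : ∀ x u v, κ.form x (A x u) v = κ.form x u (A x v)) (hκ : ClosedForm I κ.form)
    (s : Finset ℝ) (hann : ∀ x, aeval (A x) (∏ a ∈ s, (X - C a)) = 0) :
    ClosedForm I (fun x ↦ (κ.form x).comp (A x)) := by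
  intro U hU V₁ V₂ V₃ h₁ h₂ h₃ x hx
  have hΩ : IsDiffAlternating (fun x ↦ (κ.form x).comp (A x)) :=
    { swap := fun x u v ↦ by
        rw [ContinuousLinearMap.comp_apply, ContinuousLinearMap.comp_apply, hA, κ.swap]
      mdifferentiableAt := fun hU hX hY _ hx ↦
        κ.mdifferentiableAt_pairing hU (hs.smoothFieldOn hX) hY hx }
  -- The extra node keeps the set nonempty, so that the Lagrange basis sums to `1`. It does no harm:
  -- `(X - a) e_a` still vanishes on all of `s`.
  set t := insert 0 s with ht
  set e : ℝ → ℝ[X] := Lagrange.basis t id with he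
  have hsum : ∑ a ∈ t, e a = 1 :=
    Lagrange.sum_basis Function.injective_id.injOn (Finset.insert_nonempty _ _)
  have heig : ∀ a ∈ t, ∀ (V : VField I M) (y : M),
      A y (applyField I (polyEnd A (e a)) V y) = a • applyField I (polyEnd A (e a)) V y := by
    intro a ha V y
    have h1 : ∏ a ∈ s, (X - C a) ∣ (X - C a) * e a := by
      refine prod_X_sub_C_dvd_of_eval_eq_zero s _ fun b hb ↦ ?_
      by_cases hab : a = b
      · simp [hab]
      · have := Lagrange.eval_basis_of_ne (s := t) (v := (id : ℝ → ℝ)) hab (Finset.mem_insert_of_mem hb)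
        rw [id_eq] at this
        rw [eval_mul, this, mul_zero]
    have h2 : aeval (A y) ((X - C a) * e a) = 0 := by
      obtain ⟨q, hq⟩ := h1
      rw [hq, map_mul, hann, zero_mul]
    rw [map_mul, map_sub, aeval_X, aeval_C, Algebra.algebraMap_eq_smul_one] at h2
    have h3 := DFunLike.congr_fun h2 (V y)
    exact sub_eq_zero.1 h3
  have hsm : ∀ (p : ℝ[X]) (V : VField I M), SmoothFieldOn I V U →
      SmoothFieldOn I (applyField I (polyEnd A p) V) U :=
    fun p V hV ↦ (hs.polyEnd p).smoothFieldOn hV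
  -- the identity field is a sum of the spectral projections
  have key : ∀ V₁ V₂ V₃ : VField I M, SmoothFieldOn I V₁ U → SmoothFieldOn I V₂ U →
      SmoothFieldOn I V₃ U → (∀ a ∈ t, extDerivTwo I (fun x ↦ (κ.form x).comp (A x))
        (applyField I (polyEnd A (e a)) V₁) V₂ V₃ x = 0) →
      extDerivTwo I (fun x ↦ (κ.form x).comp (A x)) V₁ V₂ V₃ x = 0 := by
    intro V₁ V₂ V₃ h₁ h₂ h₃ h
    have hadd : ∀ p q : ℝ[X], extDerivTwo I (fun x ↦ (κ.form x).comp (A x))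
        (applyField I (polyEnd A (p + q)) V₁) V₂ V₃ x =
        extDerivTwo I (fun x ↦ (κ.form x).comp (A x)) (applyField I (polyEnd A p) V₁) V₂ V₃ x +
        extDerivTwo I (fun x ↦ (κ.form x).comp (A x)) (applyField I (polyEnd A q) V₁) V₂ V₃ x := by
      intro p q
      rw [← extDerivTwo_add_left hΩ hU (hsm p V₁ h₁) (hsm q V₁ h₁) h₂ h₃ hx]
      congr 1
      funext y
      simp [applyField, polyEnd]
    have h1 := Finset.sum_induction e (fun p ↦ extDerivTwo I (fun x ↦ (κ.form x).comp (A x))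
        (applyField I (polyEnd A p) V₁) V₂ V₃ x = 0)
      (fun p q hp hq ↦ by rw [hadd, hp, hq, add_zero])
      (by simpa using hadd 0 0) h
    rw [hsum] at h1
    convert h1 using 2
    funext y
    simp [applyField, polyEnd]
  refine key _ _ _ h₁ h₂ h₃ fun a ha ↦ ?_
  -- Additivity is available in the first slot only, so each field is moved there in turn.
  rw [extDerivTwo_swap_left hΩ, neg_eq_zero]
  refine key _ _ _ h₂ (hsm _ _ h₁) h₃ fun b hb ↦ ?_
  rw [extDerivTwo_swap_right hΩ, extDerivTwo_swap_left hΩ, neg_neg]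
  refine key _ _ _ h₃ (hsm _ _ h₂) (hsm _ _ h₁) fun c hc ↦ ?_
  exact extDerivTwo_eigenfields hN hA hκ hU (hsm _ _ h₃) (hsm _ _ h₂) (hsm _ _ h₁)
    (heig c hc V₃) (heig b hb V₂) (heig a ha V₁) hx

end Closed

end AlmostSymplectic

namespace AlmostSymplectic

open Polynomial

/-! ### Polar decomposition and constancy of the spectrum. -/

section PointwiseAlgebra

variable {V : Type*} [AddCommGroup V] [Module ℝ V] [TopologicalSpace V] [IsTopologicalAddGroup V]
  [ContinuousConstSMul ℝ V]

theorem toLinearMap_aeval (A : V →L[ℝ] V) (p : ℝ[X]) :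
    ((aeval A p : V →L[ℝ] V) : V →ₗ[ℝ] V) = aeval (A : V →ₗ[ℝ] V) p :=
  (aeval_algHom_apply ({ ContinuousLinearMap.toLinearMapRingHom (R₁ := ℝ) (M₁ := V) with
    commutes' := fun _ ↦ rfl } : (V →L[ℝ] V) →ₐ[ℝ] (V →ₗ[ℝ] V)) A p).symm

theorem aeval_selfAdjoint (B : V →L[ℝ] V →L[ℝ] ℝ) {A : V →L[ℝ] V}
    (hA : ∀ u v, B (A u) v = B u (A v)) (p : ℝ[X]) (u v : V) :
    B (aeval A p u) v = B u (aeval A p v) := by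
  induction p using Polynomial.induction_on' with
  | add p q hp hq => simp [hp, hq]
  | monomial n a =>
    have h : ∀ u v, B ((A ^ n) u) v = B u ((A ^ n) v) := by
      induction n with
      | zero => simp
      | succ n ih =>
        intro u v
        have h1 : (A ^ (n + 1)) v = A ((A ^ n) v) := by
          rw [pow_succ']
          rfl
        rw [h1, ← hA, ← ih, pow_succ]
        rfl
    simp only [aeval_monomial, Algebra.algebraMap_eq_smul_one, smul_mul_assoc, one_mul, smul_apply,
      map_smul, h]

omit [ContinuousConstSMul ℝ V] in
/-- The positive polar factor of a map `R` that is skew for `g` is a square root of `-R²`. -/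
theorem polar_relations [FiniteDimensional ℝ V] {g : V →L[ℝ] V →L[ℝ] ℝ}
    (gp : ∀ u, u ≠ 0 → 0 < g u u)
    {R S J : V →L[ℝ] V} (hR : ∀ u v, g (R u) v = - g u (R v))
    (hS : ∀ u v, g (S u) v = g u (S v)) (hJ : ∀ u v, g (J u) (J v) = g u v)
    (hRS : ∀ u, R u = S (J u)) : S * S = -(R * R) := by
  have gz : ∀ u, g u u = 0 → u = 0 := fun u hu ↦ by
    by_contra h
    exact (gp u h).ne' hu
  have hinj : Function.Injective (J : V →ₗ[ℝ] V) := by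
    rw [injective_iff_map_eq_zero]
    intro u hu
    refine gz u ?_
    rw [← hJ]
    have : J u = 0 := hu
    simp [this]
  have hsurj := LinearMap.surjective_of_injective hinj
  -- `J(Ru) + Su` is orthogonal to every `Jw`, because `g(Ru, w) = -g(u, SJw) = -g(Su, Jw)`; and `J`
  -- is onto.
  have hJR : ∀ u, J (R u) = - S u := by
    intro u
    rw [← sub_eq_zero]
    refine gz _ ?_
    obtain ⟨w, hw⟩ := hsurj (J (R u) - - S u)
    replace hw : J w = J (R u) - - S u := hw
    rw [← hw]
    nth_rewrite 1 [hw]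
    rw [map_sub, map_neg, sub_apply, neg_apply, hJ, hR, hS, hRS]
    ring
  ext u
  change S (S u) = - R (R u)
  rw [hRS (R u), hJR, map_neg, neg_neg]

end PointwiseAlgebra

variable {E : Type*} [NormedAddCommGroup E] [NormedSpace ℝ E]
  {H : Type*} [TopologicalSpace H] {I : ModelWithCorners ℝ E H}
  {M : Type*} [TopologicalSpace M] [ChartedSpace H M]
  [IsManifold I ∞ M]

theorem ClosedForm.neg {Ω : BilinField I M} (h : ClosedForm I Ω) :
    ClosedForm I (fun x ↦ -Ω x) := by
  intro U hU X Y Z hX hY hZ x hx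
  have h0 := h U hU X Y Z hX hY hZ x hx
  have hd : ∀ X Y Z : VField I M,
      derivPairing I (fun x ↦ -Ω x) X Y Z x = - derivPairing I Ω X Y Z x := by
    intro X Y Z
    have h1 : (fun y ↦ (-Ω y) (Y y) (Z y)) = - fun y ↦ Ω y (Y y) (Z y) := rfl
    rw [derivPairing, derivPairing, h1, mfderiv_neg]
    rfl
  rw [extDerivTwo] at h0
  simp only [extDerivTwo, hd, neg_apply]
  linear_combination -h0

instance finiteDimensional_tangentSpace [FiniteDimensional ℝ E] (x : M) :
    FiniteDimensional ℝ (TangentSpace I x) :=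
  inferInstanceAs (FiniteDimensional ℝ E)

/-- The trace of a polynomial in a Nijenhuis operator that is skew for a metric is constant. -/
theorem NijenhuisZero.trace_aeval_const [FiniteDimensional ℝ E] [I.Boundaryless]
    [PreconnectedSpace M] (g : RiemMetric I M) {R : EndField I M} (hs : SmoothEnd I R)
    (hN : NijenhuisZero I R) (hR : IsSkew g R) (p : ℝ[X]) (x y : M) :
    LinearMap.trace ℝ (TangentSpace I x)
      (aeval (R x : TangentSpace I x →ₗ[ℝ] TangentSpace I x) p) =
    LinearMap.trace ℝ (TangentSpace I y)
      (aeval (R y : TangentSpace I y →ₗ[ℝ] TangentSpace I y) p) := by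
  have hodd : ∀ k, Odd k → ∀ x, LinearMap.trace ℝ (TangentSpace I x)
      ((R x : TangentSpace I x →ₗ[ℝ] TangentSpace I x) ^ k) = 0 := by
    intro k hk x
    refine trace_eq_zero_of_skew
      ((ContinuousLinearMap.coeLM ℝ).comp (g.inner x : _ →ₗ[ℝ] _)) (fun u hu ↦ ?_) _ ?_
    · by_contra h
      exact (g.pos x u h).ne' (hu u)
    · have h : ∀ k : ℕ, ∀ u v, g.inner x (((R x : TangentSpace I x →ₗ[ℝ] TangentSpace I x) ^ k) u) v
          = (-1) ^ k * g.inner x u (((R x : TangentSpace I x →ₗ[ℝ] TangentSpace I x) ^ k) v) := by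
        intro k
        induction k with
        | zero => simp
        | succ k ih =>
          intro u v
          have h1 := hR x u (((R x : TangentSpace I x →ₗ[ℝ] TangentSpace I x) ^ k) v)
          have h2 : ((R x : TangentSpace I x →ₗ[ℝ] TangentSpace I x) ^ (k + 1)) v =
              R x (((R x : TangentSpace I x →ₗ[ℝ] TangentSpace I x) ^ k) v) := by
            rw [pow_succ', Module.End.mul_apply]
            rfl
          rw [h2, pow_succ, Module.End.mul_apply, ih, ContinuousLinearMap.coe_coe, h1]
          ring
      intro u v
      have h2 := h k u v
      rw [hk.neg_one_pow, neg_one_mul] at h2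
      exact h2
  have hpow : ∀ k x y, LinearMap.trace ℝ (TangentSpace I x)
      ((R x : TangentSpace I x →ₗ[ℝ] TangentSpace I x) ^ k) =
      LinearMap.trace ℝ (TangentSpace I y)
      ((R y : TangentSpace I y →ₗ[ℝ] TangentSpace I y) ^ k) := by
    intro k x y
    rcases Nat.even_or_odd k with hk | hk
    · match k, hk with
      | 0, _ =>
        rw [pow_zero, pow_zero, LinearMap.trace_one, LinearMap.trace_one]
        rfl
      | 1, hk => exact absurd hk (by decide)
      | j + 2, hk =>
        -- For an even exponent `j + 2` the preceding power is odd, hence traceless.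
        exact hN.trace_pow_const hs j (hodd (j + 1) (by grind)) x y
    · rw [hodd k hk, hodd k hk]
  induction p using Polynomial.induction_on' with
  | add p q hp hq => rw [map_add, map_add, map_add, map_add, hp, hq]
  | monomial n a =>
    simp only [aeval_monomial, Algebra.algebraMap_eq_smul_one, smul_mul_assoc, one_mul, map_smul,
      hpow n x y]

theorem isSkew_of_form_eq {κ : AlmostSymplecticForm I M} {g : RiemMetric I M} {R : EndField I M}
    (hR : ∀ x u v, g.inner x u v = κ.form x (R x u) v) : IsSkew g R := by
  intro x u v
  rw [g.symm, hR, κ.swap, ← hR]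

/-- A Nijenhuis operator that is skew for a metric has constant spectrum: the positive operator
`-R²` is annihilated by a polynomial with constant coefficients and distinct positive roots. -/
theorem NijenhuisZero.exists_annihilator [FiniteDimensional ℝ E] [I.Boundaryless]
    [PreconnectedSpace M] (g : RiemMetric I M) {R : EndField I M} (hs : SmoothEnd I R)
    (hN : NijenhuisZero I R) (hR : IsSkew g R) (hinj : ∀ x u, R x u = 0 → u = 0) :
    ∃ s : Finset ℝ, (∀ a ∈ s, 0 < a) ∧ ∀ x, aeval (-(R x * R x)) (∏ a ∈ s, (X - C a)) = 0 := by
  rcases isEmpty_or_nonempty M with hM | ⟨⟨x₀⟩⟩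
  · exact ⟨∅, by simp, fun x ↦ isEmptyElim x⟩
  have hsym : ∀ x u v, g.inner x ((-(R x * R x)) u) v = g.inner x u ((-(R x * R x)) v) := by
    intro x u v
    change g.inner x (-(R x (R x u))) v = g.inner x u (-(R x (R x v)))
    rw [map_neg, map_neg, neg_apply, hR, hR, neg_neg]
  have hpos : ∀ x u, u ≠ 0 → 0 < g.inner x ((-(R x * R x)) u) u := by
    intro x u hu
    change 0 < g.inner x (-(R x (R x u))) u
    rw [map_neg, neg_apply, hR, neg_neg]
    exact g.pos x _ fun h ↦ hu (hinj x u h)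
  let B : ∀ x : M, TangentSpace I x →ₗ[ℝ] TangentSpace I x →ₗ[ℝ] ℝ := fun x ↦
    (ContinuousLinearMap.coeLM ℝ).comp (g.inner x : TangentSpace I x →ₗ[ℝ] _)
  obtain ⟨s, hs0, hs1⟩ := exists_finset_aeval_prod_eq_zero (B x₀) (g.symm x₀) (g.pos x₀)
    (-(R x₀ * R x₀) : TangentSpace I x₀ →L[ℝ] TangentSpace I x₀) (hsym x₀) (hpos x₀)
  refine ⟨s, hs0, fun x ↦ ?_⟩
  set P : ℝ[X] := ∏ a ∈ s, (X - C a) with hP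
  have hcomp : ∀ x, aeval (R x) ((P * P).comp (-(X * X))) =
      aeval (-(R x * R x)) P * aeval (-(R x * R x)) P := by
    intro x
    rw [aeval_comp, map_mul]
    simp
  -- `P` enters squared so that the vanishing of the trace forces `P(-R²) = 0` by symmetry.
  have htr := hN.trace_aeval_const g hs hR ((P * P).comp (-(X * X))) x x₀
  rw [← toLinearMap_aeval, ← toLinearMap_aeval, hcomp, hcomp] at htr
  have h0 : aeval (-(R x₀ * R x₀)) P = 0 := by
    have := toLinearMap_aeval (-(R x₀ * R x₀)) P
    rw [hs1] at this
    exact ContinuousLinearMap.coe_injective this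
  rw [h0, zero_mul] at htr
  have h1 := eq_zero_of_symmetric_of_trace_sq (B x) (g.symm x) (g.pos x)
    (aeval (-(R x * R x)) P : TangentSpace I x →L[ℝ] TangentSpace I x)
    (aeval_selfAdjoint (g.inner x) (hsym x) P)
    (htr.trans (map_zero (LinearMap.trace ℝ (TangentSpace I x₀))))
  exact ContinuousLinearMap.coe_injective h1

/-- The orthogonal polar factor of a skew Nijenhuis operator `R`, and its positive polar factor,
are polynomials in `R` with constant coefficients. -/
theorem exists_polyEnd_eq_polar_factors [FiniteDimensional ℝ E] [I.Boundaryless]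
    [PreconnectedSpace M] (g : RiemMetric I M) {R S J : EndField I M} (hs : SmoothEnd I R)
    (hN : NijenhuisZero I R) (hR : IsSkew g R)
    (hS : ∀ x u v, g.inner x (S x u) v = g.inner x u (S x v))
    (hSp : ∀ x u, u ≠ 0 → 0 < g.inner x (S x u) u)
    (hJ : ∀ x u v, g.inner x (J x u) (J x v) = g.inner x u v)
    (hRS : ∀ x u, R x u = S x (J x u)) :
    (∃ p, J = polyEnd R p) ∧ (∃ q : ℝ[X], S = polyEnd R (q.comp (X * X))) ∧
      (∀ x, J x * J x = -1) ∧
      ∃ t : Finset ℝ, ∀ x, aeval (S x) (∏ a ∈ t, (X - C a)) = 0 := by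
  have hSS : ∀ x, S x * S x = -(R x * R x) := fun x ↦
    polar_relations (g.pos x) (hR x) (hS x) (hJ x) (hRS x)
  have hinj : ∀ x u, R x u = 0 → u = 0 := by
    intro x u hu
    by_contra h
    have h1 : J x u ≠ 0 := fun h1 ↦ (g.pos x u h).ne' (by rw [← hJ, h1]; simp)
    have h2 := hSp x _ h1
    rw [← hRS, hu] at h2
    simp at h2
  obtain ⟨s, hs0, hs1⟩ := hN.exists_annihilator g hs hR hinj
  have hann : ∀ x, aeval (S x) (∏ a ∈ s.image Real.sqrt, (X - C a)) = 0 := by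
    intro x
    have h1 := aeval_prod_sqrt_eq_zero
      ((ContinuousLinearMap.coeLM ℝ).comp (g.inner x : TangentSpace I x →ₗ[ℝ] _)) (g.pos x)
      (S x : TangentSpace I x →ₗ[ℝ] TangentSpace I x) (hSp x) s hs0 (by
        have h2 := toLinearMap_aeval (S x * S x) (∏ a ∈ s, (X - C a))
        rw [hSS, hs1, ← hSS] at h2
        exact h2.symm)
    rw [← toLinearMap_aeval] at h1
    exact ContinuousLinearMap.coe_injective h1
  obtain ⟨r, hr⟩ := exists_dvd_X_mul_comp_sub_one (s.image Real.sqrt) fun a ha ↦ by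
    obtain ⟨b, hb, rfl⟩ := Finset.mem_image.1 ha
    exact Real.sqrt_pos.2 (hs0 b hb)
  -- `r(S²)` is the inverse of `S` at every point, with the same `r`.
  have hinv : ∀ x, S x * aeval (S x * S x) r = 1 := by
    intro x
    obtain ⟨q, hq⟩ := hr
    have h1 := congrArg (aeval (S x)) hq
    rw [map_mul, hann, zero_mul, map_sub, map_mul, aeval_X, aeval_comp, map_mul, aeval_X,
      map_one] at h1
    exact sub_eq_zero.1 h1
  have hcomm : ∀ x, aeval (S x * S x) r * S x = S x * aeval (S x * S x) r := by
    intro x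
    have h1 := ((Commute.all (r.comp (X * X)) X).map (aeval (S x))).eq
    rwa [aeval_comp, map_mul, aeval_X] at h1
  have hRr : ∀ x, aeval (R x) (r.comp (-(X * X))) = aeval (S x * S x) r := by
    intro x
    rw [aeval_comp, hSS]
    simp
  have hJeq : ∀ x, J x = aeval (S x * S x) r * R x := by
    intro x
    have h1 : R x = S x * J x := by
      ext u
      exact hRS x u
    rw [h1, ← mul_assoc, hcomm, hinv, one_mul]
  refine ⟨⟨r.comp (-(X * X)) * X, ?_⟩, ⟨-(X * r.comp (-X)), ?_⟩, fun x ↦ ?_, _, hann⟩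
  · funext x
    rw [hJeq, polyEnd, map_mul, hRr, aeval_X]
  · funext x
    have h1 : (-(X * r.comp (-X)) : ℝ[X]).comp (X * X) = (-(X * X)) * r.comp (-(X * X)) := by
      rw [neg_comp, mul_comp, X_comp, comp_assoc]
      simp
    rw [polyEnd, h1, map_mul, hRr, map_neg, map_mul, aeval_X, ← hSS, mul_assoc, hinv, mul_one]
  · have h1 : R x * aeval (S x * S x) r = aeval (S x * S x) r * R x := by
      have h2 := ((Commute.all X (r.comp (-(X * X)))).map (aeval (R x))).eq
      rwa [hRr, aeval_X] at h2
    have h3 : R x * R x = -(S x * S x) := by rw [hSS, neg_neg]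
    calc J x * J x = aeval (S x * S x) r * (R x * aeval (S x * S x) r) * R x := by
          rw [hJeq]; simp only [mul_assoc]
      _ = aeval (S x * S x) r * aeval (S x * S x) r * (R x * R x) := by
          rw [h1]; simp only [mul_assoc]
      _ = -(aeval (S x * S x) r * (aeval (S x * S x) r * S x) * S x) := by
          rw [h3]; simp only [mul_assoc, mul_neg]
      _ = -1 := by rw [hcomm, hinv, mul_one, hcomm, hinv]

end AlmostSymplectic

end

theorem theorem5p1 (n : ℕ) {M : Type*} [TopologicalSpace M] [T2Space M]
    [SecondCountableTopology M] [ConnectedSpace M]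
    [ChartedSpace (EuclideanSpace ℝ (Fin (2 * n))) M] [IsManifold (𝓡 (2 * n)) ∞ M]
    (κ : AlmostSymplectic.AlmostSymplecticForm (𝓡 (2 * n)) M)
    (g : AlmostSymplectic.RiemMetric (𝓡 (2 * n)) M)
    (hvol : AlmostSymplectic.HasVolumeForm (𝓡 (2 * n)) n κ g)
    (R : AlmostSymplectic.EndField (𝓡 (2 * n)) M)
    (hR : ∀ x u v, g.inner x u v = κ.form x (R x u) v)
    (hN : AlmostSymplectic.NijenhuisZero (𝓡 (2 * n)) R)
    (J : AlmostSymplectic.EndField (𝓡 (2 * n)) M)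
    (hJ : AlmostSymplectic.IsPolarOrthogonalFactor g R J) :
    AlmostSymplectic.SmoothEnd (𝓡 (2 * n)) J ∧
    AlmostSymplectic.IsSkew g J ∧
    AlmostSymplectic.NijenhuisZero (𝓡 (2 * n)) J ∧
    (AlmostSymplectic.ClosedForm (𝓡 (2 * n)) κ.form → AlmostSymplectic.IsKahler g J) := by
  obtain ⟨S, hS, hSp, hJo, hRS⟩ := hJ
  have hs := AlmostSymplectic.smoothEnd_of_form_eq κ g.contMDiff hR
  have hskew := AlmostSymplectic.isSkew_of_form_eq hR
  obtain ⟨⟨p, hp⟩, ⟨q, hq⟩, hJJ, t, ht⟩ :=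
    AlmostSymplectic.exists_polyEnd_eq_polar_factors g hs hN hskew hS hSp hJo hRS
  have hJs : AlmostSymplectic.SmoothEnd (𝓡 (2 * n)) J := hp ▸ hs.polyEnd p
  have hJN : AlmostSymplectic.NijenhuisZero (𝓡 (2 * n)) J := hp ▸ hN.polyEnd hs p
  have hJJ' : ∀ x u, J x (J x u) = -u := fun x u ↦ DFunLike.congr_fun (hJJ x) u
  refine ⟨hJs, fun x u v ↦ ?_, hJN, fun hκ ↦ ⟨hJs, hJJ', hJo, hJN, ?_⟩⟩
  -- Orthogonality together with `J² = -1` gives skewness.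
  · rw [← hJo x (J x u) v, hJJ', map_neg, neg_apply]
  · have hSκ : ∀ x u v, κ.form x (S x u) v = κ.form x u (S x v) := by
      intro x u v
      have hRκ : ∀ u v, κ.form x (R x u) v = - κ.form x u (R x v) := fun u v ↦ by
        rw [← hR, g.symm, hR, κ.swap]
      -- `R` is skew for `κ` too, so `R²`, and with it every polynomial in `R²`, is self-adjoint for
      -- `κ`.
      have h1 : S x = Polynomial.aeval (R x * R x) q := by
        rw [hq, AlmostSymplectic.polyEnd, Polynomial.aeval_comp, map_mul, Polynomial.aeval_X]
      rw [h1]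
      refine AlmostSymplectic.aeval_selfAdjoint (κ.form x) (fun u v ↦ ?_) q u v
      change κ.form x (R x (R x u)) v = κ.form x u (R x (R x v))
      rw [hRκ, hRκ, neg_neg]
    have hcl := (AlmostSymplectic.closedForm_comp (hq ▸ hs.polyEnd _) (hq ▸ hN.polyEnd hs _)
      hSκ hκ t ht).neg
    convert hcl using 1
    funext x
    ext u v
    change g.inner x (J x u) v = -(κ.form x (S x u) v)
    rw [hR, hRS, hJJ', map_neg, map_neg, neg_apply]
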